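/- A closed, densely defined operator $(A,D(A))$ with dense range on a complex Banach space $X$ is called sectorial if there is $\varphi\in(0,\frac{\pi}{2})$ such that $\sigma(A)\subset\overline{\Sigma_\varphi}$ and $\sup_{\lambda\notin\overline{\Sigma_\varphi}}\|\lambda(\lambda-A)^{-1}\|<\infty$, where $\Sigma_\varphi=\{z\in\mathbb{C}\setminus\{0\}:|\arg z|<\varphi\}$. It is invertible if $0\in\rho(A)$. For an invertible sectorial operator $A$ the space $D(A)$ carries the norm $\|x\|_{D(A)}=\|Ax\|_X$, the domain of the fractional power $A^\theta$ carries the norm $\|x\|_{D(A^\theta)}=\|A^\theta x\|_X$, and $[X,D(A)]_\theta$ denotes the complex interpolation space: the set of all $f(\theta)$, normed by $\|x\|_{[X,D(A)]_\theta}=\inf\{\max(\sup_{t\in\mathbb{R}}\|f(it)\|_X,\ \sup_{t\in\mathbb{R}}\|f(1+it)\|_{D(A)}) : f(\theta)=x\}$, where $f$ ranges over the bounded continuous functions $\{0\le\operatorname{Re}z\le1\}\to X+D(A)$ that are analytic in $0<\operatorname{Re}z<1$ and for which $f(i\,\cdot)\colon\mathbb{R}\to X$ and $f(1+i\,\cdot)\colon\mathbb{R}\to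 D(A)$ are bounded and continuous. Proposition. Let $(A_j,D(A_j))_{j\in J}$ be a family of invertible sectorial operators on a complex Banach space $X$. Suppose that the operators $A_j$ have bounded imaginary powers (that is, $A_j^{it}$ is a bounded operator on $X$ for all $t\in\mathbb{R}$) and that there are constants $M\ge0$ and $\omega\ge0$ with $$\|A_j^{it}\|\le Me^{\omega|t|}\qquad\text{for all }t\in\mathbb{R}\text{ and }j\in J.$$ Then for every $\theta\in(0,1)$ there exists a constant $C>0$ such that for all $j\in J$ one has $D(A_j^\theta)=[X,D(A_j)]_\theta$ as subsets of $X$ and $$C^{-1}\|x\|_{D(A_j^\theta)}\le\|x\|_{[X,D(A_j)]_\theta}\le C\|x\|_{D(A_j^\theta)}\qquad\text{for all }x\in D(A_j^\theta).$$ -/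

import Mathlib

open scoped BoundedContinuousFunction

noncomputable section

namespace BIP

/-! ### Unbounded operators: resolvents and sectoriality -/

section Operators

variable {X : Type*} [NormedAddCommGroup X] [NormedSpace ℂ X]

/-- The bounded operator `R` is a two-sided inverse of `z - A : D(A) → X`. -/
def IsResolventAt (A : X →ₗ.[ℂ] X) (z : ℂ) (R : X →L[ℂ] X) : Prop :=
  (∀ y : X, ∃ h : R y ∈ A.domain, z • R y - A ⟨R y, h⟩ = y) ∧
    ∀ x : A.domain, R (z • (x : X) - A x) = x

/-- The resolvent set `ρ(A)`. -/
def resolventSet (A : X →ₗ.[ℂ] X) : Set ℂ :=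
  {z | ∃ R : X →L[ℂ] X, IsResolventAt A z R}

/-- The spectrum `σ(A)`. -/
def spectrum (A : X →ₗ.[ℂ] X) : Set ℂ := (resolventSet A)ᶜ

open Classical in
/-- The resolvent `R(z, A) = (z - A)⁻¹` for `z ∈ ρ(A)` (and `0` for `z ∈ σ(A)`). -/
def resolvent (A : X →ₗ.[ℂ] X) (z : ℂ) : X →L[ℂ] X :=
  if h : z ∈ resolventSet A then h.choose else 0

theorem isResolventAt_resolvent {A : X →ₗ.[ℂ] X} {z : ℂ} (h : z ∈ resolventSet A) :
    IsResolventAt A z (resolvent A z) := by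
  unfold resolvent
  rw [dif_pos h]
  exact h.choose_spec

/-- The open sector `Σ_φ` of half-angle `φ` around the positive real axis. -/
def sector (φ : ℝ) : Set ℂ := {z | z ≠ 0 ∧ |z.arg| < φ}

/-- Sectorial operators: closed, densely defined, with dense range, and with the resolvent
estimate outside a sector of half-angle less than `π / 2`. -/
structure IsSectorial (A : X →ₗ.[ℂ] X) : Prop where
  isClosed : A.IsClosed
  dense_domain : Dense (A.domain : Set X)
  dense_range : Dense (Set.range A)
  resolvent_bound : ∃ φ ∈ Set.Ioo (0 : ℝ) (Real.pi / 2),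
    spectrum A ⊆ closure (sector φ) ∧
      ∃ K : ℝ, ∀ z ∉ closure (sector φ), ‖z • resolvent A z‖ ≤ K

/-- `A` is invertible: `0 ∈ ρ(A)`. -/
def IsInvertible (A : X →ₗ.[ℂ] X) : Prop := (0 : ℂ) ∈ resolventSet A

/-- An unbounded operator which is in fact an everywhere defined, bounded operator. -/
def IsBoundedOperator (T : X →ₗ.[ℂ] X) : Prop :=
  T.domain = ⊤ ∧ ∃ c : ℝ, ∀ x : T.domain, ‖T x‖ ≤ c * ‖(x : X)‖

end Operators

/-! ### Fractional powers of sectorial operators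

For an integer `n > |Re z|` let `e(a) = a ^ n * (1 + a) ^ (-2 * n)`. As in the regularization
definition of the functional calculus, `A ^ z = e(A)⁻¹ (e(a) a ^ z)(A)`, where the bounded operator
`(e(a) a ^ z)(A)` is given by the Balakrishnan-Komatsu integral, that is, by inserting `A` in
`a ^ z = Γ(2n) / (Γ(n + z) Γ(n - z)) * ∫₀^∞ t ^ (z + n - 1) a ^ n (t + a) ^ (-2 * n) dt`.
The integral, after multiplication by `e(A)`, converges absolutely in operator norm. -/

section FractionalPowers

variable {X : Type*} [NormedAddCommGroup X] [NormedSpace ℂ X]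

/-- `(t + A)⁻¹`. -/
def shiftInv (A : X →ₗ.[ℂ] X) (t : ℝ) : X →L[ℂ] X := -resolvent A (-(t : ℂ))

/-- `A ^ n (t + A) ^ (-2 * n)`, written by means of `A (t + A)⁻¹ = 1 - t (t + A)⁻¹`. -/
def regularizer (A : X →ₗ.[ℂ] X) (n : ℕ) (t : ℝ) : X →L[ℂ] X :=
  (1 - (t : ℂ) • shiftInv A t) ^ n * shiftInv A t ^ n

/-- The least natural number `n` with `n > |Re z|`. -/
def powOrder (z : ℂ) : ℕ := ⌊|z.re|⌋₊ + 1

/-- The bounded operator `A ^ n (1 + A) ^ (-2 * n) A ^ z`, with `n = powOrder z`. -/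
def regularizedPow (A : X →ₗ.[ℂ] X) (z : ℂ) : X →L[ℂ] X :=
  (Complex.Gamma (2 * (powOrder z : ℂ)) /
      (Complex.Gamma ((powOrder z : ℂ) + z) * Complex.Gamma ((powOrder z : ℂ) - z))) •
    ∫ t in Set.Ioi (0 : ℝ), (t : ℂ) ^ (z + (powOrder z : ℂ) - 1) •
      (regularizer A (powOrder z) t * regularizer A (powOrder z) 1)

/-- The graph of `A ^ z`: all `(x, y)` with `(e(a) a ^ z)(A) x = e(A) y`. -/
def fracPowGraph (A : X →ₗ.[ℂ] X) (z : ℂ) : Submodule ℂ (X × X) :=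
  LinearMap.ker
    ((regularizedPow A z : X →ₗ[ℂ] X) ∘ₗ LinearMap.fst ℂ X X -
      (regularizer A (powOrder z) 1 : X →ₗ[ℂ] X) ∘ₗ LinearMap.snd ℂ X X)

/-- The fractional power `A ^ z` of a sectorial operator `A`, with its natural domain. -/
def fracPow (A : X →ₗ.[ℂ] X) (z : ℂ) : X →ₗ.[ℂ] X := (fracPowGraph A z).toLinearPMap

/-- `A` has bounded imaginary powers. -/
def HasBoundedImaginaryPowers (A : X →ₗ.[ℂ] X) : Prop :=
  ∀ t : ℝ, IsBoundedOperator (fracPow A (t * Complex.I))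

end FractionalPowers

/-! ### The domain of an invertible operator as a Banach space -/

section DomainSpace

variable {X : Type*} [NormedAddCommGroup X] [NormedSpace ℂ X]

/-- `D(A)` for an invertible operator `A`, to be normed by `‖A x‖`. -/
def DomainSpace (A : X →ₗ.[ℂ] X) (_hA : IsInvertible A) : Type _ := A.domain

variable {A : X →ₗ.[ℂ] X} {hA : IsInvertible A}

instance : AddCommGroup (DomainSpace A hA) := inferInstanceAs (AddCommGroup A.domain)

instance : Module ℂ (DomainSpace A hA) := inferInstanceAs (Module ℂ A.domain)

/-- `A` as a linear map on `D(A)`. -/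
def DomainSpace.apply (A : X →ₗ.[ℂ] X) (hA : IsInvertible A) : DomainSpace A hA →ₗ[ℂ] X := A.toFun

theorem DomainSpace.apply_injective : Function.Injective (DomainSpace.apply A hA) := by
  intro x y hxy
  have h := (isResolventAt_resolvent hA).2
  have hx := h x
  have hy := h y
  have e : A x = A y := hxy
  rw [zero_smul, zero_sub] at hx hy
  rw [e] at hx
  exact Subtype.ext (hx.symm.trans hy)

/-- The norm `‖x‖_{D(A)} = ‖A x‖`. -/
instance : NormedAddCommGroup (DomainSpace A hA) :=
  NormedAddCommGroup.induced _ _ (DomainSpace.apply A hA) DomainSpace.apply_injective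

theorem DomainSpace.norm_def (x : DomainSpace A hA) : ‖x‖ = ‖DomainSpace.apply A hA x‖ := rfl

instance : NormedSpace ℂ (DomainSpace A hA) where
  norm_smul_le c x := by
    rw [DomainSpace.norm_def, DomainSpace.norm_def, map_smul, norm_smul]

/-- The continuous inclusion of `D(A)` in `X`. -/
def DomainSpace.incl (A : X →ₗ.[ℂ] X) (hA : IsInvertible A) : DomainSpace A hA →L[ℂ] X :=
  LinearMap.mkContinuous (show DomainSpace A hA →ₗ[ℂ] X from A.domain.subtype) ‖resolvent A 0‖ <| by
    intro x
    have hx := (isResolventAt_resolvent hA).2 x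
    rw [zero_smul, zero_sub, map_neg] at hx
    calc ‖A.domain.subtype x‖ = ‖resolvent A 0 (A x)‖ := by rw [← norm_neg (resolvent A 0 (A x)), hx]; rfl
      _ ≤ ‖resolvent A 0‖ * ‖x‖ := (resolvent A 0).le_opNorm _

theorem DomainSpace.incl_injective : Function.Injective (DomainSpace.incl A hA) :=
  fun _ _ h => Subtype.ext h

instance [CompleteSpace X] : CompleteSpace (DomainSpace A hA) := by
  have hi : Isometry (DomainSpace.apply A hA) :=
    AddMonoidHomClass.isometry_of_norm _ (fun _ => rfl)
  have hs : Function.Surjective (DomainSpace.apply A hA) := by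
    intro y
    obtain ⟨h1, h2⟩ := (isResolventAt_resolvent hA).1 y
    rw [zero_smul, zero_sub] at h2
    refine ⟨-(⟨_, h1⟩ : A.domain), ?_⟩
    change A (-⟨_, h1⟩) = y
    rw [A.map_neg, h2]
  exact (IsometryEquiv.mk (Equiv.ofBijective _ ⟨hi.injective, hs⟩) hi).symm.completeSpace_iff.mp ‹_›

end DomainSpace

/-! ### Complex interpolation of a Banach couple

The couple consists of two Banach spaces `X`, `Y` with continuous embeddings `i`, `k` into a
Hausdorff topological vector space `Z`. -/

section Interpolation

variable {X Y Z : Type*} [NormedAddCommGroup X] [NormedSpace ℂ X]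
  [NormedAddCommGroup Y] [NormedSpace ℂ Y]
  [AddCommGroup Z] [Module ℂ Z] [TopologicalSpace Z] [IsTopologicalAddGroup Z]

/-- The map `(x, y) ↦ x + y` with values in `Z`. -/
def sumMap (i : X →L[ℂ] Z) (k : Y →L[ℂ] Z) : WithLp 1 (X × Y) →L[ℂ] Z :=
  (i.coprod k).comp (WithLp.prodContinuousLinearEquiv 1 ℂ X Y : WithLp 1 (X × Y) →L[ℂ] X × Y)

/-- The sum `X + Y`; its quotient norm is `‖z‖ = inf {‖x‖ + ‖y‖ : z = x + y}`. -/
abbrev SumSpace (i : X →L[ℂ] Z) (k : Y →L[ℂ] Z) : Type _ :=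
  WithLp 1 (X × Y) ⧸ LinearMap.ker (sumMap i k : WithLp 1 (X × Y) →ₗ[ℂ] Z)

variable (i : X →L[ℂ] Z) (k : Y →L[ℂ] Z)

/-- The class of `x + y` in `X + Y`. -/
def SumSpace.mk (x : X) (y : Y) : SumSpace i k := Submodule.Quotient.mk (WithLp.toLp 1 (x, y))

/-- The injection of `X + Y` in `Z`. -/
def SumSpace.toAmbient : SumSpace i k →ₗ[ℂ] Z :=
  (LinearMap.ker (sumMap i k : WithLp 1 (X × Y) →ₗ[ℂ] Z)).liftQ
    (sumMap i k : WithLp 1 (X × Y) →ₗ[ℂ] Z) le_rfl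

/-- The space `𝒥(X, Y)`: bounded continuous functions from the closed strip `0 ≤ Re z ≤ 1` to
`X + Y`, analytic in the open strip, whose restrictions to the lines `Re z = 0` and `Re z = 1` are
bounded continuous functions with values in `X` and in `Y`. -/
structure StripFunction where
  toFun : ℂ → SumSpace i k
  left : ℝ →ᵇ X
  right : ℝ →ᵇ Y
  continuousOn : ContinuousOn toFun {z | 0 ≤ z.re ∧ z.re ≤ 1}
  bounded : ∃ B : ℝ, ∀ z : ℂ, 0 ≤ z.re → z.re ≤ 1 → ‖toFun z‖ ≤ B
  differentiableOn : DifferentiableOn ℂ toFun {z | 0 < z.re ∧ z.re < 1}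
  left_eq : ∀ t : ℝ, toFun (t * Complex.I) = SumSpace.mk i k (left t) 0
  right_eq : ∀ t : ℝ, toFun (1 + t * Complex.I) = SumSpace.mk i k 0 (right t)

variable {i k} in
/-- The norm of `𝒥(X, Y)`: the larger one of the two suprema over the boundary lines. -/
def StripFunction.bdNorm (f : StripFunction i k) : ℝ := max ‖f.left‖ ‖f.right‖

/-- The complex interpolation space `[X, Y]_θ`, as a subset of `Z`. -/
def interpSpace (θ : ℝ) : Set Z :=
  {z | ∃ f : StripFunction i k, SumSpace.toAmbient i k (f.toFun θ) = z}

/-- The norm of `[X, Y]_θ`. -/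
def interpNorm (θ : ℝ) (z : Z) : ℝ :=
  sInf {r | ∃ f : StripFunction i k, SumSpace.toAmbient i k (f.toFun θ) = z ∧ f.bdNorm = r}

end Interpolation

end BIP

end

noncomputable section

open Set Filter Topology MeasureTheory

namespace BIP

/-! ### Mellin integrals of functions with polynomial decay -/

section Mellin

variable {E : Type*} [NormedAddCommGroup E]

/-! Formally, `A ^ z f(z)` has the boundary values `A ^ (it) f(it)` and `A ^ (it) A f(1 + it)`, both
controlled through `M e^(ω|t|)`; the factor `exp ((z - θ) ^ 2)` absorbs the exponential and equals
`1` at `θ`. So `A ^ θ f(θ)` is bounded by the boundary norm of `f`. Conversely `x = A ^ (-θ) y` is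
the value at `θ` of `exp ((z - θ) ^ 2) A ^ (-z) y`, whose boundary values in `X` and `D(A)` are
bounded by a multiple of `‖y‖`.

Everything is carried out with bounded operators. With `S t = (t + A)⁻¹`, `powSubOne S z` is `A ^ (z
- 1)`, and `mem_fracPowGraph_iff` rewrites `A ^ z x = y` as `A ^ (z - 1) x = A⁻¹ y`. Two such
formulas are glued by `mul_powSubOne` into `powSubTwo`, that is `A ^ (z - 2)`, holomorphic near the
closed strip.

For the first embedding (`exists_powSubOne_eq_of_strip`) `A ^ z f(z)` need not make sense inside the
strip. The Cauchy formula `two_pi_smul_eq_integral_strip` is therefore applied to `exp ((z - θ) ^ 2)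
A ^ (z - 2) f(z)`; both boundary integrands contain `A⁻²`, which leaves the integrals and cancels.
For the second (`exists_strip_function`) the function is written down for `y = A⁻¹ u`, bounded by
`‖y‖` through Phragmén-Lindelöf, and extended to all `y` by density.

Recognizing its value at `θ` requires `A ^ (-θ - 1) A ^ (θ - 1) = κ A⁻²` with `κ ≠ 0` independent of
`A` (`exists_powSubOne_mul`). There `A` is replaced by `s + A`: a suitable product is constant in
`s`, the limit `s → 0` gives the left side and `s → ∞` the scalar.

The resolvent bound `L` varies with the operator. It serves only for convergence, holomorphy and a
priori boundedness; the final constants depend on `M`, `ω` and `θ` alone. -/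

theorem isBigO_of_norm_le_div_pow {F : ℝ → E} {C : ℝ} {n : ℕ}
    (hb : ∀ t, 0 < t → ‖F t‖ ≤ C / (1 + t) ^ n) :
    F =O[atTop] (fun t : ℝ => t ^ (-(n : ℝ))) ∧ F =O[𝓝[>] 0] (fun t : ℝ => t ^ (-(0 : ℝ))) := by
  have hC : 0 ≤ C := by
    have h := (norm_nonneg _).trans (hb 1 one_pos)
    by_contra hC
    exact absurd h (not_le.2 (div_neg_of_neg_of_pos (not_le.1 hC) (by positivity)))
  constructor
  · refine Asymptotics.IsBigO.of_bound C ?_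
    filter_upwards [eventually_gt_atTop 0] with t ht
    refine (hb t ht).trans ?_
    rw [Real.rpow_neg ht.le, Real.rpow_natCast, norm_inv, Real.norm_of_nonneg (by positivity),
      ← div_eq_mul_inv]
    gcongr
    linarith
  · refine Asymptotics.IsBigO.of_bound C ?_
    filter_upwards [self_mem_nhdsWithin] with t ht
    have ht : 0 < t := ht
    refine (hb t ht).trans ?_
    simp only [neg_zero, Real.rpow_zero, norm_one, mul_one]
    exact div_le_self hC (one_le_pow₀ (by linarith))

variable [NormedSpace ℂ E]

theorem mellinConvergent_of_norm_le_div_pow {F : ℝ → E} {C : ℝ} {n : ℕ}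
    (hc : ContinuousOn F (Ioi 0)) (hb : ∀ t, 0 < t → ‖F t‖ ≤ C / (1 + t) ^ n) {s : ℂ}
    (h0 : 0 < s.re) (hn : s.re < n) : MellinConvergent F s :=
  mellinConvergent_of_isBigO_rpow (hc.locallyIntegrableOn measurableSet_Ioi)
    (isBigO_of_norm_le_div_pow hb).1 hn (isBigO_of_norm_le_div_pow hb).2 h0

theorem differentiableAt_mellin_of_norm_le_div_pow {F : ℝ → E} {C : ℝ} {n : ℕ}
    (hc : ContinuousOn F (Ioi 0)) (hb : ∀ t, 0 < t → ‖F t‖ ≤ C / (1 + t) ^ n) {s : ℂ}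
    (h0 : 0 < s.re) (hn : s.re < n) : DifferentiableAt ℂ (mellin F) s :=
  mellin_differentiableAt_of_isBigO_rpow (hc.locallyIntegrableOn measurableSet_Ioi)
    (isBigO_of_norm_le_div_pow hb).1 hn (isBigO_of_norm_le_div_pow hb).2 h0

/-- The function is the norm of the Mellin integrand of `(1 + t) ^ (-n)` at `x + 1`. It is the
dominating function in the limits below. -/
theorem integrableOn_rpow_div_pow {x : ℝ} {n : ℕ} (h0 : -1 < x) (hn : x + 1 < n) :
    IntegrableOn (fun t : ℝ => t ^ x / (1 + t) ^ n) (Ioi 0) := by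
  have hc : ContinuousOn (fun t : ℝ => (((1 + t) ^ n)⁻¹ : ℂ)) (Ioi 0) := by
    refine ContinuousOn.inv₀ (by fun_prop) fun t ht => pow_ne_zero _ ?_
    have ht : 0 < t := ht
    exact_mod_cast (by linarith : (1 + t : ℝ) ≠ 0)
  have hb : ∀ t : ℝ, 0 < t → ‖(((1 + t) ^ n)⁻¹ : ℂ)‖ ≤ 1 / (1 + t) ^ n := by
    intro t ht
    rw [norm_inv, norm_pow, one_div]
    have : ‖(1 + t : ℂ)‖ = 1 + t := by
      rw [← Complex.ofReal_one, ← Complex.ofReal_add, Complex.norm_of_nonneg (by linarith)]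
    rw [this]
  have h := mellinConvergent_of_norm_le_div_pow (s := (x : ℂ) + 1) hc hb
    (by simpa using by linarith) (by simpa using hn)
  refine (Integrable.norm h).congr ?_
  filter_upwards [ae_restrict_mem measurableSet_Ioi] with t ht
  have ht : 0 < t := ht
  have h1 : ‖(1 + t : ℂ)‖ = 1 + t := by
    rw [← Complex.ofReal_one, ← Complex.ofReal_add, Complex.norm_of_nonneg (by linarith)]
  rw [norm_smul, norm_inv, norm_pow, h1, Complex.norm_cpow_eq_rpow_re_of_pos ht]
  simp [div_eq_mul_inv]

/-- If `t ^ s • F` is a primitive of a Mellin integrand and `F` decays, the integral vanishes. -/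
theorem integral_eq_zero_of_hasDerivAt_cpow_smul [CompleteSpace E] {F G : ℝ → E} {C : ℝ} {n : ℕ}
    (hb : ∀ t, 0 < t → ‖F t‖ ≤ C / (1 + t) ^ n) {s : ℂ} (h0 : 0 < s.re) (hn : s.re < n)
    (hd : ∀ t : ℝ, 0 < t → HasDerivAt (fun t : ℝ => (t : ℂ) ^ s • F t) (G t) t)
    (hG : IntegrableOn G (Ioi 0)) : ∫ t in Ioi (0 : ℝ), G t = 0 := by
  have hs : s ≠ 0 := fun h => by simp [h] at h0
  have hO := isBigO_of_norm_le_div_pow hb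
  have hcp : ∀ l : Filter ℝ, (∀ᶠ t in l, 0 < t) →
      (fun t : ℝ => (t : ℂ) ^ s) =O[l] fun t : ℝ => t ^ s.re := by
    intro l hl
    refine Asymptotics.IsBigO.of_bound 1 ?_
    filter_upwards [hl] with t ht
    rw [Complex.norm_cpow_eq_rpow_re_of_pos ht, one_mul]
    exact le_abs_self _
  have htop : Tendsto (fun t : ℝ => (t : ℂ) ^ s • F t) atTop (𝓝 0) := by
    refine ((hcp atTop (eventually_gt_atTop 0)).smul hO.1).trans_tendsto ?_
    refine (tendsto_rpow_neg_atTop (sub_pos.2 hn)).congr' ?_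
    filter_upwards [eventually_gt_atTop 0] with t ht
    rw [smul_eq_mul, ← Real.rpow_add ht]
    congr 1
    ring
  -- The value `F 0` is irrelevant, because it is multiplied by `0 ^ s = 0`.
  have hbot : ContinuousWithinAt (fun t : ℝ => (t : ℂ) ^ s • F t) (Ici 0) 0 := by
    rw [← Ioi_insert, continuousWithinAt_insert_self]
    change Tendsto _ _ (𝓝 (((0 : ℝ) : ℂ) ^ s • F 0))
    rw [Complex.ofReal_zero, Complex.zero_cpow hs, zero_smul]
    refine ((hcp (𝓝[>] 0) self_mem_nhdsWithin).smul hO.2).trans_tendsto ?_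
    simp only [neg_zero, Real.rpow_zero, smul_eq_mul, mul_one]
    have := (Real.continuousAt_rpow_const 0 s.re (Or.inr h0.le)).tendsto
    rw [Real.zero_rpow h0.ne'] at this
    exact this.mono_left nhdsWithin_le_nhds
  have := integral_Ioi_of_hasDerivAt_of_tendsto hbot (fun t ht => hd t ht) hG htop
  rw [this]
  simp [Complex.zero_cpow hs]

end Mellin

/-! ### Resolvents on the negative half-line -/

section ResolventFamily

variable {X : Type*} [NormedAddCommGroup X] [NormedSpace ℂ X]

/-- A family behaving like `t ↦ (t + A)⁻¹`, `t ≥ 0`, for an invertible sectorial operator `A`. -/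
structure IsResolventFamily (S : ℝ → X →L[ℂ] X) (L : ℝ) : Prop where
  sub_eq : ∀ s t, 0 ≤ s → 0 ≤ t → S s - S t = ((t - s : ℝ) : ℂ) • (S s * S t)
  bound : ∀ t, 0 ≤ t → ‖S t‖ ≤ L / (1 + t)

namespace IsResolventFamily

variable {S : ℝ → X →L[ℂ] X} {L : ℝ}

theorem nonneg (hS : IsResolventFamily S L) : 0 ≤ L := by
  simpa using (norm_nonneg _).trans (hS.bound 0 le_rfl)

theorem norm_le (hS : IsResolventFamily S L) {t : ℝ} (ht : 0 ≤ t) : ‖S t‖ ≤ L :=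
  (hS.bound t ht).trans (div_le_self hS.nonneg (by linarith))

theorem comm (hS : IsResolventFamily S L) {s t : ℝ} (hs : 0 ≤ s) (ht : 0 ≤ t) :
    S s * S t = S t * S s := by
  rcases eq_or_ne s t with rfl | hst
  · rfl
  have h1 := hS.sub_eq s t hs ht
  have h2 := hS.sub_eq t s ht hs
  have h3 : ((t - s : ℝ) : ℂ) • (S s * S t) = ((t - s : ℝ) : ℂ) • (S t * S s) := by
    rw [← h1, ← neg_sub (S t), h2, ← neg_smul]
    push_cast
    congr 1
    ring
  refine smul_right_injective _ ?_ h3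
  exact_mod_cast sub_ne_zero.2 hst.symm

/-- `t (t + s + A)⁻¹ (s + A)⁻¹ = (s + A)⁻¹ - (t + s + A)⁻¹`. -/
theorem smul_mul_eq (hS : IsResolventFamily S L) {s t : ℝ} (hs : 0 ≤ s) (ht : 0 ≤ t) :
    (t : ℂ) • (S (s + t) * S s) = S s - S (s + t) := by
  rw [hS.sub_eq s (s + t) hs (by linarith), hS.comm hs (by linarith)]
  simp

theorem shift (hS : IsResolventFamily S L) {s : ℝ} (hs : 0 ≤ s) :
    IsResolventFamily (fun t => S (s + t)) L where
  sub_eq a b ha hb := by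
    rw [hS.sub_eq (s + a) (s + b) (by linarith) (by linarith)]
    congr 2
    ring
  bound t ht := (hS.bound _ (by linarith)).trans (by
    have := hS.nonneg
    gcongr
    linarith)

theorem norm_sub_le (hS : IsResolventFamily S L) {s t : ℝ} (hs : 0 ≤ s) (ht : 0 ≤ t) :
    ‖S s - S t‖ ≤ L * L * |s - t| := by
  have hL := hS.nonneg
  rw [hS.sub_eq s t hs ht, norm_smul, Complex.norm_real, Real.norm_eq_abs, abs_sub_comm, mul_comm]
  gcongr
  exact (norm_mul_le _ _).trans
    (mul_le_mul (hS.norm_le hs) (hS.norm_le ht) (norm_nonneg _) hL)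

theorem continuousOn (hS : IsResolventFamily S L) : ContinuousOn S (Ici 0) := by
  have hL := hS.nonneg
  refine (LipschitzOnWith.of_dist_le_mul (K := ⟨L * L, by positivity⟩) ?_).continuousOn
  intro s hs t ht
  rw [dist_eq_norm, Real.dist_eq]
  exact hS.norm_sub_le hs ht

theorem hasDerivAt (hS : IsResolventFamily S L) {t : ℝ} (ht : 0 < t) :
    HasDerivAt S (-(S t * S t)) t := by
  rw [hasDerivAt_iff_tendsto_slope]
  have hc : ContinuousAt S t := hS.continuousOn.continuousAt (Ici_mem_nhds ht)
  have h1 : Tendsto (fun s => -(S s * S t)) (𝓝[≠] t) (𝓝 (-(S t * S t))) :=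
    ((hc.tendsto.mul_const _).neg).mono_left nhdsWithin_le_nhds
  refine h1.congr' ?_
  filter_upwards [self_mem_nhdsWithin, nhdsWithin_le_nhds (Ioi_mem_nhds ht)] with s hst hs
  have hs : 0 < s := hs
  have hst : s - t ≠ 0 := sub_ne_zero.2 hst
  rw [slope_def_module, hS.sub_eq s t hs.le ht.le, Complex.coe_smul, smul_smul, ← neg_sub s t,
    mul_neg, inv_mul_cancel₀ hst, neg_smul, one_smul]

theorem continuousOn_sq (hS : IsResolventFamily S L) :
    ContinuousOn (fun t => S t * S t) (Ioi 0) :=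
  (hS.continuousOn.mul hS.continuousOn).mono Ioi_subset_Ici_self

theorem norm_sq_le (hS : IsResolventFamily S L) {t : ℝ} (ht : 0 ≤ t) :
    ‖S t * S t‖ ≤ L ^ 2 / (1 + t) ^ 2 := by
  rw [← div_pow, sq]
  exact (norm_mul_le _ _).trans (mul_le_mul (hS.bound t ht) (hS.bound t ht) (norm_nonneg _)
    (div_nonneg hS.nonneg (by linarith)))

end IsResolventFamily

/-- `∫₀^∞ t ^ z (t + A)⁻² dt`. -/
def powIntegral (S : ℝ → X →L[ℂ] X) (z : ℂ) : X →L[ℂ] X :=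
  ∫ t in Ioi (0 : ℝ), (t : ℂ) ^ z • (S t * S t)

/-- The normalizing factor in the integral formula for `A ^ (z - 1)`. -/
def powCoeff (z : ℂ) : ℂ := (Complex.Gamma (1 + z))⁻¹ * (Complex.Gamma (1 - z))⁻¹

/-- The bounded operator `A ^ (z - 1)` for `|Re z| < 1`. -/
def powSubOne (S : ℝ → X →L[ℂ] X) (z : ℂ) : X →L[ℂ] X := powCoeff z • powIntegral S z

namespace IsResolventFamily

variable {S : ℝ → X →L[ℂ] X} {L : ℝ}

theorem powIntegral_eq_mellin (z : ℂ) :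
    powIntegral S z = mellin (fun t => S t * S t) (z + 1) := by
  simp [powIntegral, mellin]

theorem integrableOn_powIntegral (hS : IsResolventFamily S L) {z : ℂ} (h0 : -1 < z.re)
    (h1 : z.re < 1) : IntegrableOn (fun t : ℝ => (t : ℂ) ^ z • (S t * S t)) (Ioi 0) := by
  have := mellinConvergent_of_norm_le_div_pow (s := z + 1) hS.continuousOn_sq
    (fun t ht => hS.norm_sq_le (le_of_lt ht)) (by simp; linarith) (by simp; linarith)
  simpa [MellinConvergent] using this

theorem differentiableAt_powIntegral (hS : IsResolventFamily S L) {z : ℂ} (h0 : -1 < z.re)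
    (h1 : z.re < 1) : DifferentiableAt ℂ (powIntegral S) z := by
  have h := differentiableAt_mellin_of_norm_le_div_pow (s := z + 1) hS.continuousOn_sq
    (fun t ht => hS.norm_sq_le (le_of_lt ht)) (by simp; linarith) (by simp; linarith)
  have h2 : powIntegral S = fun z => mellin (fun t => S t * S t) (z + 1) :=
    funext powIntegral_eq_mellin
  rw [h2]
  exact DifferentiableAt.fun_comp' (g := mellin fun t => S t * S t) z h
    (by fun_prop : DifferentiableAt ℂ (fun z : ℂ => z + 1) z)

theorem differentiable_powCoeff : Differentiable ℂ powCoeff := by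
  unfold powCoeff
  exact (Complex.differentiable_one_div_Gamma.comp (by fun_prop : Differentiable ℂ fun z : ℂ => 1 + z)).mul
    (Complex.differentiable_one_div_Gamma.comp (by fun_prop : Differentiable ℂ fun z : ℂ => 1 - z))

theorem differentiableAt_powSubOne (hS : IsResolventFamily S L) {z : ℂ} (h0 : -1 < z.re)
    (h1 : z.re < 1) : DifferentiableAt ℂ (powSubOne S) z :=
  (differentiable_powCoeff z).smul (hS.differentiableAt_powIntegral h0 h1)

/-- `A ^ (-1) A ^ (z - 1) = A ^ (z - 2)`. -/
theorem mul_powSubOne [CompleteSpace X] (hS : IsResolventFamily S L) {z : ℂ} (h0 : 0 < z.re)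
    (h1 : z.re < 1) : S 0 * powSubOne S z = powSubOne S (z - 1) := by
  have hz : z ≠ 0 := fun h => by simp [h] at h0
  have hz1 : 1 - z ≠ 0 := fun h => by
    have := congrArg Complex.re h
    simp at this
    linarith
  have hi1 := hS.integrableOn_powIntegral (z := z) (by linarith) h1
  have hi2 := hS.integrableOn_powIntegral (z := z - 1) (by simpa using h0) (by simp; linarith)
  have hi1' : IntegrableOn (fun t : ℝ => (t : ℂ) ^ z • (S t * S t * S 0)) (Ioi 0) := by
    have := ((ContinuousLinearMap.mul ℂ (X →L[ℂ] X)).flip (S 0)).integrable_comp hi1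
    simpa [IntegrableOn] using this
  have e1 : S 0 * powIntegral S z = ∫ t in Ioi (0 : ℝ), (t : ℂ) ^ z • (S t * S t * S 0) := by
    have := (ContinuousLinearMap.mul ℂ (X →L[ℂ] X) (S 0)).integral_comp_comm hi1
    rw [powIntegral, ← ContinuousLinearMap.mul_apply' ℂ, ← this]
    refine setIntegral_congr_fun measurableSet_Ioi fun t ht => ?_
    have ht : 0 < t := ht
    simp only [ContinuousLinearMap.mul_apply', mul_smul_comm]
    rw [← mul_assoc, hS.comm le_rfl ht.le, mul_assoc, hS.comm le_rfl ht.le, mul_assoc]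
  -- the primitive `t ^ z S_t S_0`
  have key : ∫ t in Ioi (0 : ℝ), (z • ((t : ℂ) ^ (z - 1) • (S t * S t)) -
      (1 - z) • ((t : ℂ) ^ z • (S t * S t * S 0))) = 0 := by
    have hG := (hi2.smul z).sub (hi1'.smul (1 - z))
    refine integral_eq_zero_of_hasDerivAt_cpow_smul (F := fun t => S t * S 0) (n := 1) (C := L * L) (s := z) ?_ h0 (by simpa using h1) ?_ hG
    · intro t ht
      rw [pow_one]
      refine (norm_mul_le _ _).trans ?_
      rw [mul_div_right_comm]
      exact mul_le_mul (hS.bound t ht.le) (hS.norm_le le_rfl) (norm_nonneg _)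
        (div_nonneg hS.nonneg (by linarith))
    · intro t ht
      have hd := (hS.hasDerivAt ht).mul_const (S 0)
      have hp := hasDerivAt_ofReal_cpow_const ht.ne' hz
      have e : (t : ℂ) ^ z • (S t * S t * S 0) =
          (t : ℂ) ^ (z - 1) • (S t * S 0) - (t : ℂ) ^ (z - 1) • (S t * S t) := by
        have h2 := hS.smul_mul_eq le_rfl ht.le
        rw [zero_add] at h2
        have h3 : (t : ℂ) ^ z = (t : ℂ) ^ (z - 1) * t := by
          rw [Complex.cpow_sub _ _ (by exact_mod_cast ht.ne'), Complex.cpow_one, div_mul_cancel₀ _ (by exact_mod_cast ht.ne')]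
        rw [h3, mul_smul, mul_assoc, ← mul_smul_comm, h2, mul_sub, smul_sub]
      convert! hp.smul hd using 1
      simp only [neg_mul, smul_neg]
      rw [e]
      module
  have key2 : z • powIntegral S (z - 1) = (1 - z) • (S 0 * powIntegral S z) := by
    have h := integral_sub (hi2.smul z) (hi1'.smul (1 - z))
    simp only [Pi.smul_apply] at h
    rw [h, integral_smul, integral_smul, ← e1] at key
    exact sub_eq_zero.1 key
  have key3 : S 0 * powIntegral S z = (z / (1 - z)) • powIntegral S (z - 1) := by
    rw [div_eq_inv_mul, mul_smul, key2, smul_smul, inv_mul_cancel₀ hz1, one_smul]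
  rw [powSubOne, powSubOne, mul_smul_comm, key3, smul_smul]
  congr 1
  -- The factor `z / (1 - z)` left by the integration by parts is `powCoeff (z - 1) / powCoeff z`.
  have g1 : Complex.Gamma (1 + z) = z * Complex.Gamma z := by
    rw [add_comm, Complex.Gamma_add_one z hz]
  have g2 : Complex.Gamma (1 - (z - 1)) = (1 - z) * Complex.Gamma (1 - z) := by
    rw [← Complex.Gamma_add_one _ hz1]
    congr 1
    ring
  have g3 : 1 + (z - 1) = z := by ring
  rw [powCoeff, powCoeff, g1, g2, g3]
  field_simp

end IsResolventFamily

end ResolventFamily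

/-! ### Dependence of the power integrals on a shift of `A` -/

section PowerLaw

variable {X : Type*} [NormedAddCommGroup X] [NormedSpace ℂ X]
  {S : ℝ → X →L[ℂ] X} {L : ℝ}

/-- `∫₀^∞ t ^ z (1 + t) ^ (-2) dt`. -/
def scalarPowIntegral (z : ℂ) : ℂ := ∫ t in Ioi (0 : ℝ), (t : ℂ) ^ z * ((1 + (t : ℂ)) ^ 2)⁻¹

theorem commute_powIntegral [CompleteSpace X] {T : X →L[ℂ] X} (z : ℂ)
    (h : ∀ t, 0 < t → Commute T (S t)) : Commute T (powIntegral S z) := by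
  by_cases hi : IntegrableOn (fun t : ℝ => (t : ℂ) ^ z • (S t * S t)) (Ioi 0)
  · have h1 := (ContinuousLinearMap.mul ℂ (X →L[ℂ] X) T).integral_comp_comm hi
    have h2 := ((ContinuousLinearMap.mul ℂ (X →L[ℂ] X)).flip T).integral_comp_comm hi
    have h3 : T * powIntegral S z = _ := h1.symm
    have h4 : powIntegral S z * T = _ := h2.symm
    rw [Commute, SemiconjBy, h3, h4]
    refine setIntegral_congr_fun measurableSet_Ioi fun t ht => ?_
    have ht := h t ht
    simpa [mul_smul_comm, smul_mul_assoc] using congrArg _ (ht.mul_right ht).eq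
  -- A divergent integral has the default value `0`, which commutes with everything.
  · rw [powIntegral, integral_undef hi]
    exact Commute.zero_right _

theorem commute_powSubOne [CompleteSpace X] {T : X →L[ℂ] X} (z : ℂ)
    (h : ∀ t, 0 < t → Commute T (S t)) : Commute T (powSubOne S z) :=
  (commute_powIntegral z h).smul_right _

namespace IsResolventFamily

theorem norm_cube_le (hS : IsResolventFamily S L) {t : ℝ} (ht : 0 ≤ t) :
    ‖S t * S t * S t‖ ≤ L ^ 3 / (1 + t) ^ 3 := by
  have h0 : 0 ≤ L / (1 + t) := div_nonneg hS.nonneg (by linarith)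
  rw [← div_pow, pow_succ]
  refine (norm_mul_le _ _).trans (mul_le_mul ?_ (hS.bound t ht) (norm_nonneg _) (by positivity))
  rw [div_pow]
  exact hS.norm_sq_le ht

theorem integrableOn_cube (hS : IsResolventFamily S L) {z : ℂ} (h0 : -1 < z.re)
    (h1 : z.re < 2) : IntegrableOn (fun t : ℝ => (t : ℂ) ^ z • (S t * S t * S t)) (Ioi 0) := by
  have := mellinConvergent_of_norm_le_div_pow (s := z + 1)
    (hS.continuousOn_sq.mul (hS.continuousOn.mono Ioi_subset_Ici_self))
    (fun t ht => hS.norm_cube_le (le_of_lt ht)) (by simp; linarith) (by simp; linarith)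
  simpa [MellinConvergent] using this

/-- Integrate the derivative of `t ^ (z + 1) A⁻¹ (t + A)⁻²`, after removing the extra power of `t`
by `t A⁻¹ (t + A)⁻¹ = A⁻¹ - (t + A)⁻¹`. Applied to a shifted family, it evaluates the derivative in
the shift. -/
theorem two_smul_integral_cube [CompleteSpace X] (hS : IsResolventFamily S L) {z : ℂ}
    (h0 : -1 < z.re) (h1 : z.re < 1) :
    (2 : ℂ) • ∫ t in Ioi (0 : ℝ), (t : ℂ) ^ z • (S t * S t * S t) =
      (1 - z) • (S 0 * powIntegral S z) := by
  have hz : z + 1 ≠ 0 := fun h => by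
    have := congrArg Complex.re h
    simp at this
    linarith
  have hi1 := hS.integrableOn_powIntegral h0 h1
  have hi2 := hS.integrableOn_cube h0 (by linarith)
  have hi3 : IntegrableOn (fun t : ℝ => (t : ℂ) ^ z • (S 0 * (S t * S t))) (Ioi 0) := by
    have := (ContinuousLinearMap.mul ℂ (X →L[ℂ] X) (S 0)).integrable_comp hi1
    simpa [IntegrableOn] using this
  have e1 : S 0 * powIntegral S z = ∫ t in Ioi (0 : ℝ), (t : ℂ) ^ z • (S 0 * (S t * S t)) := by
    have := (ContinuousLinearMap.mul ℂ (X →L[ℂ] X) (S 0)).integral_comp_comm hi1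
    rw [powIntegral, ← ContinuousLinearMap.mul_apply' ℂ, ← this]
    simp
  have hG := (hi2.smul (2 : ℂ)).sub (hi3.smul (1 - z))
  have key : ∫ t in Ioi (0 : ℝ), ((2 : ℂ) • ((t : ℂ) ^ z • (S t * S t * S t)) -
      (1 - z) • ((t : ℂ) ^ z • (S 0 * (S t * S t)))) = 0 := by
    refine integral_eq_zero_of_hasDerivAt_cpow_smul (F := fun t => S 0 * (S t * S t)) (n := 2)
      (C := L * L ^ 2) (s := z + 1) ?_ (by simp; linarith) (by simp; linarith) ?_ hG
    · intro t ht
      refine (norm_mul_le _ _).trans ?_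
      rw [mul_div_assoc]
      exact mul_le_mul (hS.norm_le le_rfl) (hS.norm_sq_le ht.le) (norm_nonneg _) hS.nonneg
    · intro t ht
      have hd := ((hS.hasDerivAt ht).mul (hS.hasDerivAt ht)).const_mul (S 0)
      have hp := hasDerivAt_ofReal_cpow_const ht.ne' hz
      have e : (t : ℂ) ^ (z + 1) • (S 0 * (S t * S t * S t)) =
          (t : ℂ) ^ z • (S 0 * (S t * S t)) - (t : ℂ) ^ z • (S t * S t * S t) := by
        have h2 := hS.smul_mul_eq le_rfl ht.le
        rw [zero_add, hS.comm ht.le le_rfl] at h2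
        have ht0 : (t : ℂ) ≠ 0 := by exact_mod_cast ht.ne'
        have h3 : (t : ℂ) ^ (z + 1) = (t : ℂ) ^ z * t := by
          rw [Complex.cpow_add _ _ ht0, Complex.cpow_one]
        rw [h3, mul_smul, mul_assoc (S t), ← mul_assoc (S 0), ← smul_mul_assoc (t : ℂ), h2,
          sub_mul, smul_sub]
      convert! hp.smul hd using 1
      rw [add_sub_cancel_right]
      simp only [neg_mul, mul_neg, smul_neg, smul_add, mul_add, ← mul_assoc (S t) (S t) (S t)]
      rw [e]
      module
  have h := integral_sub (hi2.smul (2 : ℂ)) (hi3.smul (1 - z))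
  simp only [Pi.smul_apply] at h
  rw [h, integral_smul, integral_smul, ← e1] at key
  exact sub_eq_zero.1 key

theorem norm_cpow_smul_sq_shift_le (hS : IsResolventFamily S L) (z : ℂ) {s t : ℝ} (hs : 0 ≤ s)
    (ht : 0 < t) :
    ‖(t : ℂ) ^ z • (S (s + t) * S (s + t))‖ ≤ L ^ 2 * (t ^ z.re / (1 + t) ^ 2) := by
  rw [norm_smul, Complex.norm_cpow_eq_rpow_re_of_pos ht]
  calc t ^ z.re * ‖S (s + t) * S (s + t)‖ ≤ t ^ z.re * (L ^ 2 / (1 + t) ^ 2) := by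
        gcongr
        exact (hS.shift hs).norm_sq_le ht.le
    _ = _ := by ring

theorem tendsto_powIntegral_shift_zero (hS : IsResolventFamily S L) {z : ℂ} (h0 : -1 < z.re)
    (h1 : z.re < 1) :
    Tendsto (fun s => powIntegral (fun t => S (s + t)) z) (𝓝[>] 0) (𝓝 (powIntegral S z)) := by
  refine tendsto_integral_filter_of_dominated_convergence
    (fun t => L ^ 2 * (t ^ z.re / (1 + t) ^ 2)) ?_ ?_ ?_ ?_
  · filter_upwards [self_mem_nhdsWithin] with s hs
    exact ((hS.shift (le_of_lt hs)).integrableOn_powIntegral h0 h1).aestronglyMeasurable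
  · filter_upwards [self_mem_nhdsWithin] with s hs
    filter_upwards [ae_restrict_mem measurableSet_Ioi] with t ht
    exact hS.norm_cpow_smul_sq_shift_le z (le_of_lt hs) ht
  · exact (integrableOn_rpow_div_pow h0 (by norm_num; linarith)).const_mul _
  · filter_upwards [ae_restrict_mem measurableSet_Ioi] with t ht
    have ht : 0 < t := ht
    have hc : ContinuousAt S (0 + t) := hS.continuousOn.continuousAt (Ici_mem_nhds (by linarith))
    have hc' : Tendsto (fun s => S (s + t)) (𝓝[>] 0) (𝓝 (S t)) := by
      have := ContinuousAt.comp (f := fun s : ℝ => s + t) (x := 0) hc (by fun_prop)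
      simpa using! this.tendsto.mono_left nhdsWithin_le_nhds
    exact (hc'.mul hc').const_smul _

/-- Differentiation under the integral sign produces cubes of resolvents, which
`two_smul_integral_cube` converts back; the shifted family takes the value `S s` at `0`. This is
`d/ds (s + A) ^ (z - 1) = (z - 1) (s + A) ^ (z - 2)`, up to normalization. -/
theorem hasDerivAt_powIntegral_shift [CompleteSpace X] (hS : IsResolventFamily S L) {z : ℂ}
    (h0 : -1 < z.re) (h1 : z.re < 1) {s : ℝ} (hs : 0 < s) :
    HasDerivAt (fun s => powIntegral (fun t => S (s + t)) z)
      (-((1 - z) • (S s * powIntegral (fun t => S (s + t)) z))) s := by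
  have hL := hS.nonneg
  have hR := hS.shift hs.le
  have e := hR.two_smul_integral_cube h0 h1
  rw [add_zero] at e
  have hF := hasDerivAt_integral_of_dominated_loc_of_deriv_le (μ := volume.restrict (Ioi (0 : ℝ)))
    (F := fun s t => (t : ℂ) ^ z • (S (s + t) * S (s + t))) (x₀ := s) (s := Ioi 0)
    (F' := fun s t => -((2 : ℂ) • ((t : ℂ) ^ z • (S (s + t) * S (s + t) * S (s + t)))))
    (bound := fun t => 2 * L ^ 3 * (t ^ z.re / (1 + t) ^ 3))
    (Ioi_mem_nhds hs) ?_ (hR.integrableOn_powIntegral h0 h1) ?_ ?_ ?_ ?_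
  · have h2 := hF.2
    rw [integral_neg, integral_smul, e] at h2
    exact h2
  · filter_upwards [Ioi_mem_nhds hs] with s hs
    exact ((hS.shift (le_of_lt hs)).integrableOn_powIntegral h0 h1).aestronglyMeasurable
  · exact ((hR.integrableOn_cube h0 (by linarith)).smul (2 : ℂ)).neg.aestronglyMeasurable
  · filter_upwards [ae_restrict_mem measurableSet_Ioi] with t ht s hs
    have ht : 0 < t := ht
    rw [norm_neg, norm_smul, norm_smul, Complex.norm_cpow_eq_rpow_re_of_pos ht, Complex.norm_two]
    calc 2 * (t ^ z.re * ‖S (s + t) * S (s + t) * S (s + t)‖)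
        ≤ 2 * (t ^ z.re * (L ^ 3 / (1 + t) ^ 3)) := by
          gcongr
          exact (hS.shift (le_of_lt hs)).norm_cube_le ht.le
      _ = _ := by ring
  · exact (integrableOn_rpow_div_pow h0 (by norm_num; linarith)).const_mul _
  · filter_upwards [ae_restrict_mem measurableSet_Ioi] with t ht s hs
    have ht : 0 < t := ht
    have hs : 0 < s := hs
    have hd : HasDerivAt (fun s => S (s + t)) (-(S (s + t) * S (s + t))) s :=
      (hS.hasDerivAt (by linarith : 0 < s + t)).comp_add_const s t
    refine ((hd.mul hd).const_smul ((t : ℂ) ^ z)).congr_deriv ?_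
    simp only [neg_mul, mul_neg, ← mul_assoc]
    module

end IsResolventFamily

end PowerLaw

/-! ### The power law, from the limits of small and large shift -/

section PowerLaw

variable {X : Type*} [NormedAddCommGroup X] [NormedSpace ℂ X]
  {S : ℝ → X →L[ℂ] X} {L : ℝ}

namespace IsResolventFamily

theorem tendsto_atTop_zero (hS : IsResolventFamily S L) : Tendsto S atTop (𝓝 0) := by
  refine squeeze_zero_norm' (a := fun t => L / (1 + t)) ?_ ?_
  · filter_upwards [eventually_ge_atTop 0] with t ht using hS.bound t ht
  · exact Tendsto.const_div_atTop (tendsto_atTop_add_const_left _ _ tendsto_id) L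

theorem smul_mul_zero_eq (hS : IsResolventFamily S L) {s τ : ℝ} (hs : 0 < s) (hτ : 0 < τ) :
    (s : ℂ) • (S 0 * S (s + s * τ)) = (1 + (τ : ℂ))⁻¹ • (S 0 - S (s + s * τ)) := by
  have h0 : 0 ≤ s + s * τ := by positivity
  have h := hS.smul_mul_eq le_rfl h0
  have h1 : (1 + (τ : ℂ)) ≠ 0 := by exact_mod_cast (by linarith : 1 + τ ≠ 0)
  rw [zero_add] at h
  rw [← h, smul_smul, hS.comm h0 le_rfl]
  congr 1
  push_cast
  field_simp

/-- Substitute `s t` for `t` in the integral and share the two factors `A⁻¹` between the two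
resolvents, each pair being simplified by `smul_mul_zero_eq`. -/
theorem smul_mul_powIntegral_shift_eq [CompleteSpace X] (hS : IsResolventFamily S L) {z : ℂ}
    (h0 : -1 < z.re) (h1 : z.re < 1) {s : ℝ} (hs : 0 < s) :
    (s : ℂ) ^ (1 - z) • (S 0 * S 0 * powIntegral (fun t => S (s + t)) z) =
      ∫ t in Ioi (0 : ℝ), ((t : ℂ) ^ z * ((1 + (t : ℂ)) ^ 2)⁻¹) •
        ((S 0 - S (s + s * t)) * (S 0 - S (s + s * t))) := by
  have hsc : (s : ℂ) ≠ 0 := by exact_mod_cast hs.ne'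
  have hi := (hS.shift hs.le).integrableOn_powIntegral h0 h1
  have e1 : S 0 * S 0 * powIntegral (fun t => S (s + t)) z = _ :=
    ((ContinuousLinearMap.mul ℂ (X →L[ℂ] X) (S 0 * S 0)).integral_comp_comm hi).symm
  have e2 := integral_comp_mul_left_Ioi' (fun t : ℝ => ContinuousLinearMap.mul ℂ (X →L[ℂ] X)
    (S 0 * S 0) ((t : ℂ) ^ z • (S (s + t) * S (s + t)))) 0 hs
  rw [mul_zero] at e2
  rw [e1, ← e2, ← Complex.coe_smul, smul_smul, ← integral_smul]
  refine setIntegral_congr_fun measurableSet_Ioi fun t ht => ?_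
  have ht : 0 < t := ht
  have hst : 0 ≤ s + s * t := by positivity
  have e3 := hS.smul_mul_zero_eq hs ht
  have e4 : (S 0 - S (s + s * t)) = (1 + (t : ℂ)) • (s : ℂ) • (S 0 * S (s + s * t)) := by
    rw [e3, smul_smul, mul_inv_cancel₀, one_smul]
    exact_mod_cast (by linarith : 1 + t ≠ 0)
  have e5 : S 0 * S 0 * (S (s + s * t) * S (s + s * t)) =
      S 0 * S (s + s * t) * (S 0 * S (s + s * t)) := by
    have hc := hS.comm le_rfl hst
    generalize S (s + s * t) = R at hc
    generalize S 0 = P at hc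
    calc P * P * (R * R) = P * (P * R) * R := by simp only [mul_assoc]
      _ = P * (R * P) * R := by rw [hc]
      _ = P * R * (P * R) := by simp only [mul_assoc]
  have ht1 : (1 + (t : ℂ)) ≠ 0 := by exact_mod_cast (by linarith : 1 + t ≠ 0)
  simp only [ContinuousLinearMap.mul_apply', mul_smul_comm]
  rw [e4, e5]
  simp only [smul_mul_assoc, mul_smul_comm, smul_smul]
  congr 1
  rw [Complex.ofReal_mul, Complex.mul_cpow_ofReal_nonneg hs.le ht.le, Complex.cpow_sub _ _ hsc,
    Complex.cpow_one]
  have hcp : (s : ℂ) ^ z ≠ 0 := by simp [Complex.cpow_eq_zero_iff, hsc]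
  field_simp

/-- In the form of `smul_mul_powIntegral_shift_eq` the variable `s` occurs only in `S (s + s * t)`,
which tends to `0`. The factor `A⁻²` is what gives convergence in operator norm. -/
theorem tendsto_smul_mul_powIntegral_shift [CompleteSpace X] (hS : IsResolventFamily S L) {z : ℂ}
    (h0 : -1 < z.re) (h1 : z.re < 1) :
    Tendsto (fun s : ℝ => (s : ℂ) ^ (1 - z) • (S 0 * S 0 * powIntegral (fun t => S (s + t)) z))
      atTop (𝓝 (scalarPowIntegral z • (S 0 * S 0))) := by
  have hL := hS.nonneg
  rw [scalarPowIntegral, ← integral_smul_const (fun t : ℝ => (t : ℂ) ^ z * ((1 + (t : ℂ)) ^ 2)⁻¹)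
    (S 0 * S 0)]
  have h : Tendsto (fun s : ℝ => ∫ t in Ioi (0 : ℝ), ((t : ℂ) ^ z * ((1 + (t : ℂ)) ^ 2)⁻¹) •
      ((S 0 - S (s + s * t)) * (S 0 - S (s + s * t)))) atTop
      (𝓝 (∫ t in Ioi (0 : ℝ), ((t : ℂ) ^ z * ((1 + (t : ℂ)) ^ 2)⁻¹) • (S 0 * S 0))) := by
    refine tendsto_integral_filter_of_dominated_convergence
      (fun t => (t ^ z.re / (1 + t) ^ 2) * (2 * L * (2 * L))) ?_ ?_ ?_ ?_
    · filter_upwards [eventually_gt_atTop 0] with s hs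
      refine ContinuousOn.aestronglyMeasurable ?_ measurableSet_Ioi
      have hc : ContinuousOn (fun t => S (s + s * t)) (Ioi 0) :=
        hS.continuousOn.comp (by fun_prop) fun t ht => by
          have ht : 0 < t := ht
          exact mem_Ici.2 (by positivity)
      have hc2 := (continuousOn_const (c := S 0)).sub hc
      have hk : ContinuousOn (fun t : ℝ => (t : ℂ) ^ z * ((1 + (t : ℂ)) ^ 2)⁻¹) (Ioi 0) := by
        refine ContinuousOn.mul ?_ ?_
        · exact fun t ht => (Complex.continuousAt_ofReal_cpow_const t z
            (Or.inr (ne_of_gt ht))).continuousWithinAt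
        · refine ContinuousOn.inv₀ (by fun_prop) fun t ht => pow_ne_zero _ ?_
          have ht : 0 < t := ht
          exact_mod_cast (by linarith : (1 + t : ℝ) ≠ 0)
      exact hk.smul (hc2.mul hc2)
    · filter_upwards [eventually_gt_atTop 0] with s hs
      filter_upwards [ae_restrict_mem measurableSet_Ioi] with t ht
      have ht : 0 < t := ht
      have h2 : ‖S 0 - S (s + s * t)‖ ≤ 2 * L := by
        refine (_root_.norm_sub_le _ _).trans ?_
        rw [two_mul]
        exact add_le_add (hS.norm_le le_rfl) (hS.norm_le (by positivity))
      have h3 : ‖(1 + t : ℂ)‖ = 1 + t := by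
        rw [← Complex.ofReal_one, ← Complex.ofReal_add, Complex.norm_of_nonneg (by linarith)]
      rw [norm_smul, norm_mul, norm_inv, norm_pow, h3, Complex.norm_cpow_eq_rpow_re_of_pos ht,
        ← div_eq_mul_inv]
      gcongr
      exact (norm_mul_le _ _).trans (by gcongr)
    · exact (integrableOn_rpow_div_pow h0 (by norm_num; linarith)).mul_const _
    · filter_upwards [ae_restrict_mem measurableSet_Ioi] with t ht
      have ht : 0 < t := ht
      have h4 : Tendsto (fun s => s + s * t) atTop atTop := by
        have : (fun s => s + s * t) = fun s => s * (1 + t) := by ext; ring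
        rw [this]
        exact tendsto_id.atTop_mul_const (by linarith)
      have h5 := (hS.tendsto_atTop_zero.comp h4).const_sub (S 0)
      simpa using! (h5.mul h5).const_smul ((t : ℂ) ^ z * ((1 + (t : ℂ)) ^ 2)⁻¹)
  refine h.congr' ?_
  filter_upwards [eventually_gt_atTop 0] with s hs
  rw [hS.smul_mul_powIntegral_shift_eq h0 h1 hs]

theorem commute_zero_powIntegral_shift [CompleteSpace X] (hS : IsResolventFamily S L) (z : ℂ)
    {r s : ℝ} (hr : 0 ≤ r) (hs : 0 ≤ s) : Commute (S r) (powIntegral (fun t => S (s + t)) z) :=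
  commute_powIntegral z fun t ht => hS.comm hr (by linarith)

/-- `(s + A)² A⁻² (s + A)^(z - 1) (s + A)^(-z - 1)` does not depend on `s > 0`, up to constants. -/
theorem hasDerivAt_shift_product [CompleteSpace X] (hS : IsResolventFamily S L) {z : ℂ}
    (h0 : -1 < z.re) (h1 : z.re < 1) {s : ℝ} (hs : 0 < s) :
    HasDerivAt (fun s : ℝ => ((1 + (s : ℂ) • S 0) * powIntegral (fun t => S (s + t)) z) *
      ((1 + (s : ℂ) • S 0) * powIntegral (fun t => S (s + t)) (-z))) 0 s := by
  have ha : HasDerivAt (fun s : ℝ => (1 : X →L[ℂ] X) + (s : ℂ) • S 0) (S 0) s := by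
    have := (((hasDerivAt_id (s : ℂ)).comp_ofReal).smul_const (S 0)).const_add (1 : X →L[ℂ] X)
    simpa using this
  have hs0 : S 0 = (1 + (s : ℂ) • S 0) * S s := by
    have h := hS.smul_mul_eq le_rfl hs.le
    rw [zero_add, hS.comm hs.le le_rfl] at h
    rw [add_mul, one_mul, smul_mul_assoc, h]
    abel
  -- Each factor is `A⁻¹ (s + A) ^ w` up to a constant, with logarithmic derivative `w (s + A)⁻¹`;
  -- the contributions of `w = z` and `w = -z` cancel.
  have aux : ∀ w : ℂ, -1 < w.re → w.re < 1 →
      HasDerivAt (fun s : ℝ => (1 + (s : ℂ) • S 0) * powIntegral (fun t => S (s + t)) w)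
        (w • (S s * ((1 + (s : ℂ) • S 0) * powIntegral (fun t => S (s + t)) w))) s := by
    intro w hw0 hw1
    refine (ha.mul (hS.hasDerivAt_powIntegral_shift hw0 hw1 hs)).congr_deriv ?_
    have hc : Commute (S s) (1 + (s : ℂ) • S 0) :=
      (Commute.one_right _).add_right (Commute.smul_right (hS.comm hs.le le_rfl) _)
    rw [← mul_assoc, hc.eq, ← hs0, mul_neg, mul_smul_comm, ← mul_assoc, ← hs0]
    module
  refine ((aux z h0 h1).mul (aux (-z) (by simp; linarith) (by simp; linarith))).congr_deriv ?_
  have hc : Commute (S s) ((1 + (s : ℂ) • S 0) * powIntegral (fun t => S (s + t)) z) :=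
    ((Commute.one_right _).add_right (Commute.smul_right (hS.comm hs.le le_rfl) _)).mul_right
      (hS.commute_zero_powIntegral_shift z hs.le hs.le)
  rw [smul_mul_assoc, mul_smul_comm, hc.eq, mul_assoc]
  module

theorem shift_product_eq [CompleteSpace X] (hS : IsResolventFamily S L) {z : ℂ}
    (h0 : -1 < z.re) (h1 : z.re < 1) {s : ℝ} (hs : 0 < s) :
    ((1 + (s : ℂ) • S 0) * powIntegral (fun t => S (s + t)) z) *
      ((1 + (s : ℂ) • S 0) * powIntegral (fun t => S (s + t)) (-z)) =
      powIntegral S z * powIntegral S (-z) := by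
  have hn0 : -1 < (-z).re := by simp; linarith
  have hn1 : (-z).re < 1 := by simp; linarith
  set f := fun s : ℝ => ((1 + (s : ℂ) • S 0) * powIntegral (fun t => S (s + t)) z) *
      ((1 + (s : ℂ) • S 0) * powIntegral (fun t => S (s + t)) (-z)) with hf
  have hconst : ∀ r ∈ Ioi (0 : ℝ), f r = f s := fun r hr =>
    isOpen_Ioi.is_const_of_deriv_eq_zero (convex_Ioi 0).isPreconnected
      (fun x hx => (hS.hasDerivAt_shift_product h0 h1 hx).differentiableAt.differentiableWithinAt)
      (fun x hx => (hS.hasDerivAt_shift_product h0 h1 hx).deriv) hr hs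
  have hl : Tendsto (fun s : ℝ => (1 : X →L[ℂ] X) + (s : ℂ) • S 0) (𝓝[>] 0) (𝓝 1) := by
    have : Continuous fun s : ℝ => (1 : X →L[ℂ] X) + (s : ℂ) • S 0 := by fun_prop
    simpa using (this.tendsto 0).mono_left nhdsWithin_le_nhds
  have hlim := (hl.mul (hS.tendsto_powIntegral_shift_zero h0 h1)).mul
    (hl.mul (hS.tendsto_powIntegral_shift_zero hn0 hn1))
  rw [one_mul, one_mul] at hlim
  refine tendsto_nhds_unique (tendsto_const_nhds.congr' ?_) hlim
  filter_upwards [self_mem_nhdsWithin] with r hr using (hconst r hr).symm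

/-- The relation `A ^ (z - 1) A ^ (-z - 1) = A ^ (-2)`, up to the value of the constant. -/
theorem powIntegral_mul_powIntegral_neg [CompleteSpace X] (hS : IsResolventFamily S L)
    (hinj : Function.Injective (S 0)) {z : ℂ} (h0 : -1 < z.re) (h1 : z.re < 1) :
    powIntegral S z * powIntegral S (-z) =
      (scalarPowIntegral z * scalarPowIntegral (-z)) • (S 0 * S 0) := by
  have hn0 : -1 < (-z).re := by simp; linarith
  have hn1 : (-z).re < 1 := by simp; linarith
  have hl : Tendsto (fun s : ℝ => (s : ℂ)⁻¹ • (1 : X →L[ℂ] X) + S 0) atTop (𝓝 (S 0)) := by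
    have h : Tendsto (fun s : ℝ => (s : ℂ)⁻¹) atTop (𝓝 0) := by
      have := (Complex.continuous_ofReal.tendsto 0).comp tendsto_inv_atTop_zero
      simpa [Function.comp_def] using this
    simpa using (h.smul_const (1 : X →L[ℂ] X)).add_const (S 0)
  have hlim := (hl.mul (hS.tendsto_smul_mul_powIntegral_shift h0 h1)).mul
    (hl.mul (hS.tendsto_smul_mul_powIntegral_shift hn0 hn1))
  -- The additional `A⁻⁴` supplies one `A⁻²` for each of the two limits. The scalars match because
  -- `s * s = s ^ (1 - z) * s ^ (1 + z)`.
  have hK : S 0 * S 0 * (S 0 * S 0) * (powIntegral S z * powIntegral S (-z)) =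
      S 0 * (scalarPowIntegral z • (S 0 * S 0)) * (S 0 * (scalarPowIntegral (-z) • (S 0 * S 0))) := by
    refine tendsto_nhds_unique (tendsto_const_nhds.congr' ?_) hlim
    filter_upwards [eventually_gt_atTop 0] with s hs
    have hsc : (s : ℂ) ≠ 0 := by exact_mod_cast hs.ne'
    have hcV := hS.commute_zero_powIntegral_shift z le_rfl hs.le
    have hcp : (s : ℂ) ^ z ≠ 0 := by simp [Complex.cpow_eq_zero_iff, hsc]
    have e1 : (1 : X →L[ℂ] X) + (s : ℂ) • S 0 = (s : ℂ) • ((s : ℂ)⁻¹ • (1 : X →L[ℂ] X) + S 0) := by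
      rw [smul_add, smul_smul, mul_inv_cancel₀ hsc, one_smul]
    have hcT : Commute (S 0) ((s : ℂ)⁻¹ • (1 : X →L[ℂ] X) + S 0) :=
      ((Commute.one_right _).smul_right _).add_right (Commute.refl _)
    rw [← hS.shift_product_eq h0 h1 hs, e1]
    set T := (s : ℂ)⁻¹ • (1 : X →L[ℂ] X) + S 0
    set V := powIntegral (fun t => S (s + t)) z
    set W := powIntegral (fun t => S (s + t)) (-z)
    have e2 : S 0 * S 0 * (S 0 * S 0) * (T * V * (T * W)) =
        T * (S 0 * S 0 * V) * (T * (S 0 * S 0 * W)) := by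
      have hB : Commute (S 0 * S 0) T := (hcT.mul_left hcT)
      have hB2 : Commute (S 0 * S 0) V := (hcV.mul_left hcV)
      generalize S 0 * S 0 = B at hB hB2
      calc B * B * (T * V * (T * W)) = B * (B * T) * V * T * W := by simp only [mul_assoc]
        _ = B * (T * B) * V * T * W := by rw [hB.eq]
        _ = B * T * (B * V) * T * W := by simp only [mul_assoc]
        _ = B * T * (V * B) * T * W := by rw [hB2.eq]
        _ = B * T * V * (B * T) * W := by simp only [mul_assoc]
        _ = T * B * V * (T * B) * W := by rw [hB.eq]
        _ = T * (B * V) * (T * (B * W)) := by simp only [mul_assoc]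
    simp only [smul_mul_assoc, mul_smul_comm, smul_smul]
    rw [← e2]
    congr 1
    rw [Complex.cpow_sub _ _ hsc, Complex.cpow_sub _ _ hsc, Complex.cpow_neg, Complex.cpow_one]
    field_simp
  have hK2 : S 0 * S 0 * (S 0 * S 0) * (powIntegral S z * powIntegral S (-z)) =
      S 0 * S 0 * (S 0 * S 0) *
        ((scalarPowIntegral z * scalarPowIntegral (-z)) • (S 0 * S 0)) := by
    rw [hK]
    simp only [mul_smul_comm, smul_mul_assoc, smul_smul, mul_assoc]
    rw [mul_comm]
  ext x
  have := congrArg (fun T : X →L[ℂ] X => T x) hK2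
  -- Cancel `A⁻⁴`, one injective factor at a time.
  exact hinj (hinj (hinj (hinj this)))

end IsResolventFamily

theorem scalarPowIntegral_ofReal_ne_zero {x : ℝ} (h0 : -1 < x) (h1 : x < 1) :
    scalarPowIntegral (x : ℂ) ≠ 0 := by
  have hi := integrableOn_rpow_div_pow (n := 2) h0 (by norm_num; linarith)
  have e : scalarPowIntegral (x : ℂ) = ((∫ t in Ioi (0 : ℝ), t ^ x / (1 + t) ^ 2 : ℝ) : ℂ) := by
    rw [scalarPowIntegral, ← integral_complex_ofReal]
    refine setIntegral_congr_fun measurableSet_Ioi fun t ht => ?_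
    have ht : 0 < t := ht
    rw [← Complex.ofReal_cpow ht.le]
    push_cast
    rw [div_eq_mul_inv]
  rw [e]
  refine Complex.ofReal_ne_zero.2 (ne_of_gt ?_)
  rw [setIntegral_pos_iff_support_of_nonneg_ae]
  · refine lt_of_lt_of_le ?_ (measure_mono (s := Ioi 0) fun t ht => ⟨?_, ht⟩)
    · simp
    · have ht : 0 < t := ht
      exact Function.mem_support.2 (by positivity)
  · filter_upwards [ae_restrict_mem measurableSet_Ioi] with t ht
    have ht : 0 < t := ht
    simp only [Pi.zero_apply]
    positivity
  · exact hi

theorem powCoeff_ne_zero {z : ℂ} (h0 : -1 < z.re) (h1 : z.re < 1) : powCoeff z ≠ 0 :=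
  mul_ne_zero (inv_ne_zero (Complex.Gamma_ne_zero_of_re_pos (by simp; linarith)))
    (inv_ne_zero (Complex.Gamma_ne_zero_of_re_pos (by simp; linarith)))

/-- There is a constant, independent of `A`, for which `A ^ (-x - 1) A ^ (x - 1) = κ A ^ (-2)`. -/
theorem exists_powSubOne_mul {x : ℝ} (h0 : -1 < x) (h1 : x < 1) :
    ∃ κ : ℂ, κ ≠ 0 ∧ ∀ {X : Type*} [NormedAddCommGroup X] [NormedSpace ℂ X] [CompleteSpace X]
      {S : ℝ → X →L[ℂ] X} {L : ℝ}, IsResolventFamily S L → Function.Injective (S 0) →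
      powSubOne S (-x : ℂ) * powSubOne S (x : ℂ) = κ • (S 0 * S 0) := by
  have hx : ((-x : ℝ) : ℂ) = -(x : ℂ) := by push_cast; rfl
  -- Only scalar integrals enter, hence the independence of `A`. For real `x` they are integrals of
  -- positive functions, so nonvanishing needs no evaluation.
  refine ⟨powCoeff (-x) * powCoeff x * (scalarPowIntegral (-x) * scalarPowIntegral x), ?_, ?_⟩
  · refine mul_ne_zero (mul_ne_zero (powCoeff_ne_zero ?_ ?_) (powCoeff_ne_zero ?_ ?_))
      (mul_ne_zero ?_ (scalarPowIntegral_ofReal_ne_zero h0 h1))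
    · simp; linarith
    · simp; linarith
    · simpa using h0
    · simpa using h1
    · rw [← hx]
      exact scalarPowIntegral_ofReal_ne_zero (by linarith) (by linarith)
  · intro X _ _ _ S L hS hinj
    have := hS.powIntegral_mul_powIntegral_neg hinj (z := -(x : ℂ)) (by simp; linarith)
      (by simp; linarith)
    rw [neg_neg] at this
    rw [powSubOne, powSubOne, smul_mul_assoc, mul_smul_comm, this, smul_smul, smul_smul]

end PowerLaw

/-! ### The Cauchy formula in a strip -/

section Cauchy

/-- A primitive is `arctan (y / b) - (i / 2) log (b ^ 2 + y ^ 2)`; the logarithm is even and drops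
out on a symmetric interval. -/
theorem integral_inv_add_mul_I {b : ℝ} (hb : b ≠ 0) (T : ℝ) :
    ∫ y : ℝ in (-T)..T, ((b : ℂ) + y * Complex.I)⁻¹ = ((2 * Real.arctan (T / b) : ℝ) : ℂ) := by
  have hne : ∀ y : ℝ, (b : ℂ) + y * Complex.I ≠ 0 := fun y h => hb (by
    simpa using congrArg Complex.re h)
  have hpos : ∀ y : ℝ, 0 < b ^ 2 + y ^ 2 := fun y => by positivity
  have hd : ∀ y : ℝ, HasDerivAt (fun y : ℝ => ((Real.arctan (y / b) : ℝ) : ℂ) -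
      Complex.I / 2 * ((Real.log (b ^ 2 + y ^ 2) : ℝ) : ℂ)) ((b : ℂ) + y * Complex.I)⁻¹ y := by
    intro y
    have h1 : HasDerivAt (fun y : ℝ => Real.arctan (y / b)) (1 / (1 + (y / b) ^ 2) * (1 / b)) y :=
      ((hasDerivAt_id y).div_const b).arctan
    have h2 : HasDerivAt (fun y : ℝ => Real.log (b ^ 2 + y ^ 2)) ((2 * y) / (b ^ 2 + y ^ 2)) y := by
      have := (((hasDerivAt_id y).pow 2).const_add (b ^ 2)).log (hpos y).ne'
      simpa using this
    refine (h1.ofReal_comp.sub (h2.ofReal_comp.const_mul _)).congr_deriv ?_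
    have e1 : 1 / (1 + (y / b) ^ 2) * (1 / b) = b / (b ^ 2 + y ^ 2) := by
      field_simp
    have e2 : ((b : ℂ) + y * Complex.I)⁻¹ = (b - y * Complex.I) / (b ^ 2 + y ^ 2) := by
      have h3 : ((b : ℂ) ^ 2 + (y : ℂ) ^ 2) ≠ 0 := by exact_mod_cast (hpos y).ne'
      rw [eq_div_iff h3, inv_mul_eq_iff_eq_mul₀ (hne y)]
      ring_nf
      simp
    rw [e1, e2]
    push_cast
    ring
  rw [intervalIntegral.integral_eq_sub_of_hasDerivAt (fun y _ => hd y)]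
  · rw [neg_div, Real.arctan_neg, neg_sq]
    push_cast
    ring
  · refine ContinuousOn.intervalIntegrable (Continuous.continuousOn ?_)
    exact Continuous.inv₀ (by fun_prop) hne

theorem tendsto_two_mul_arctan_div {b : ℝ} (hb : 0 < b) :
    Tendsto (fun T : ℝ => ((2 * Real.arctan (T / b) : ℝ) : ℂ)) atTop (𝓝 (Real.pi : ℂ)) := by
  have h1 : Tendsto (fun T : ℝ => 2 * Real.arctan (T / b)) atTop (𝓝 Real.pi) := by
    have := ((Real.tendsto_arctan_atTop.mono_right nhdsWithin_le_nhds).comp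
      (tendsto_id.atTop_div_const hb)).const_mul 2
    rw [mul_div_cancel₀ _ (two_ne_zero)] at this
    exact this
  exact (Complex.continuous_ofReal.tendsto _).comp h1

variable {E : Type*} [NormedAddCommGroup E] [NormedSpace ℂ E]

theorem norm_inv_add_mul_I_le {b : ℝ} (hb : b ≠ 0) (t : ℝ) :
    ‖((b : ℂ) + t * Complex.I)⁻¹‖ ≤ |b|⁻¹ := by
  rw [norm_inv]
  refine inv_anti₀ (abs_pos.2 hb) ?_
  have := Complex.abs_re_le_norm ((b : ℂ) + t * Complex.I)
  simpa using this

theorem integrable_inv_smul {v : ℝ → E} {b : ℝ} (hb : b ≠ 0) (hv : Integrable v) :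
    Integrable fun t : ℝ => ((b : ℂ) + t * Complex.I)⁻¹ • v t := by
  have hne : ∀ y : ℝ, (b : ℂ) + y * Complex.I ≠ 0 := fun y h => hb (by
    simpa using congrArg Complex.re h)
  have hcont : Continuous fun y : ℝ => ((b : ℂ) + y * Complex.I)⁻¹ :=
    Continuous.inv₀ (by fun_prop) hne
  exact hv.bdd_smul |b|⁻¹ hcont.aestronglyMeasurable
    (Eventually.of_forall fun t => norm_inv_add_mul_I_le hb t)

/-- The constant `w` divided by `b + it` is not integrable on the line, so the splitting is done on
symmetric intervals, where the limit exists as a principal value. -/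
theorem slope_integral_eq [CompleteSpace E] {c v : ℂ → E} {w : E} {a b : ℝ} (hb : b ≠ 0)
    (hv : Integrable fun t : ℝ => v (a + t * Complex.I))
    (hc : ∀ t : ℝ, c (a + t * Complex.I) =
      ((b : ℂ) + t * Complex.I)⁻¹ • (v (a + t * Complex.I) - w)) (T : ℝ) :
    ∫ y : ℝ in (-T)..T, c (a + y * Complex.I) =
      (∫ y : ℝ in (-T)..T, ((b : ℂ) + y * Complex.I)⁻¹ • v (a + y * Complex.I)) -
        ((2 * Real.arctan (T / b) : ℝ) : ℂ) • w := by
  have hne : ∀ y : ℝ, (b : ℂ) + y * Complex.I ≠ 0 := fun y h => hb (by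
    simpa using congrArg Complex.re h)
  have hcont : Continuous fun y : ℝ => ((b : ℂ) + y * Complex.I)⁻¹ :=
    Continuous.inv₀ (by fun_prop) hne
  have hw : Continuous fun y : ℝ => ((b : ℂ) + y * Complex.I)⁻¹ • w := hcont.smul continuous_const
  simp_rw [hc, smul_sub]
  rw [intervalIntegral.integral_sub (integrable_inv_smul hb hv).intervalIntegrable
    (hw.intervalIntegrable _ _), intervalIntegral.integral_smul_const,
    integral_inv_add_mul_I hb]

/-- The Cauchy formula for bounded functions in the strip `0 ≤ Re z ≤ 1`. -/
theorem two_pi_smul_eq_integral_strip [CompleteSpace E] {g : ℂ → E} {θ B : ℝ}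
    (hθ : θ ∈ Ioo (0 : ℝ) 1) (hc : ContinuousOn g {z | 0 ≤ z.re ∧ z.re ≤ 1})
    (hd : DifferentiableOn ℂ g {z | 0 < z.re ∧ z.re < 1})
    (hB : ∀ z : ℂ, 0 ≤ z.re → z.re ≤ 1 → ‖g z‖ ≤ B)
    (h0 : Integrable fun t : ℝ => g (t * Complex.I))
    (h1 : Integrable fun t : ℝ => g (1 + t * Complex.I)) :
    (2 * Real.pi : ℂ) • g θ =
      (∫ t : ℝ, (((1 - θ : ℝ) : ℂ) + t * Complex.I)⁻¹ • g (1 + t * Complex.I)) -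
        ∫ t : ℝ, (((-θ : ℝ) : ℂ) + t * Complex.I)⁻¹ • g (t * Complex.I) := by
  obtain ⟨hθ0, hθ1⟩ := hθ
  have hopen : IsOpen {z : ℂ | 0 < z.re ∧ z.re < 1} :=
    (isOpen_lt continuous_const Complex.continuous_re).inter
      (isOpen_lt Complex.continuous_re continuous_const)
  have hmem : {z : ℂ | 0 < z.re ∧ z.re < 1} ∈ 𝓝 (θ : ℂ) :=
    hopen.mem_nhds ⟨by simpa using hθ0, by simpa using hθ1⟩
  have hmem' : {z : ℂ | 0 ≤ z.re ∧ z.re ≤ 1} ∈ 𝓝 (θ : ℂ) :=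
    mem_of_superset hmem fun z hz => ⟨hz.1.le, hz.2.le⟩
  -- Subtracting `g θ` removes the pole at `θ`, so Cauchy's theorem applies to `k` on the rectangles
  -- `[0, 1] × [-T, T]`. The value `g θ` reappears through the arctangents on the two vertical
  -- sides, which contribute `π` each as `T → ∞`.
  set k := dslope g (θ : ℂ) with hk
  have hkc : ContinuousOn k {z | 0 ≤ z.re ∧ z.re ≤ 1} :=
    (continuousOn_dslope hmem').2 ⟨hc, hd.differentiableAt hmem⟩
  have hkd : DifferentiableOn ℂ k {z | 0 < z.re ∧ z.re < 1} :=
    (Complex.differentiableOn_dslope hmem).2 hd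
  have hk_ne : ∀ z : ℂ, z ≠ θ → k z = (z - θ)⁻¹ • (g z - g θ) := by
    intro z hz
    rw [hk, dslope_of_ne _ hz, slope_def_module]
  have hI0 : Integrable fun t : ℝ => g ((0 : ℝ) + t * Complex.I) := by simpa using h0
  have hI1 : Integrable fun t : ℝ => g ((1 : ℝ) + t * Complex.I) := by simpa using h1
  have hrect : ∀ T : ℝ, 0 < T →
      (∫ x : ℝ in (0 : ℝ)..1, k (x + (-T : ℝ) * Complex.I)) -
        (∫ x : ℝ in (0 : ℝ)..1, k (x + T * Complex.I)) +
        Complex.I • ((∫ y : ℝ in (-T)..T, (((1 - θ : ℝ) : ℂ) + y * Complex.I)⁻¹ •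
            g ((1 : ℝ) + y * Complex.I)) - ((2 * Real.arctan (T / (1 - θ)) : ℝ) : ℂ) • g θ) -
        Complex.I • ((∫ y : ℝ in (-T)..T, (((-θ : ℝ) : ℂ) + y * Complex.I)⁻¹ •
            g ((0 : ℝ) + y * Complex.I)) - ((2 * Real.arctan (T / (-θ)) : ℝ) : ℂ) • g θ) = 0 := by
    intro T hT
    have := Complex.integral_boundary_rect_eq_zero_of_continuousOn_of_differentiableOn k
      (⟨0, -T⟩ : ℂ) (⟨1, T⟩ : ℂ) (hkc.mono ?_) (hkd.mono ?_)
    · simp only at this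
      rw [slope_integral_eq (v := g) (w := g θ) (b := 1 - θ) (by linarith) hI1 ?_,
        slope_integral_eq (v := g) (w := g θ) (b := -θ) (by linarith) hI0 ?_] at this
      · exact this
      · intro t
        rw [hk_ne]
        · congr 2
          push_cast
          ring
        · intro h
          have := congrArg Complex.re h
          simp at this
          linarith
      · intro t
        rw [hk_ne]
        · congr 2
          push_cast
          ring
        · intro h
          have := congrArg Complex.re h
          simp at this
          linarith
    · intro z hz
      have := hz.1
      simpa [uIcc_of_le] using this
    · intro z hz
      have := hz.1
      simpa using this
  -- On the horizontal sides `|z - θ| ≥ T`, so `k` is at most `2 * B / T` there.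
  have hhor : ∀ s : ℝ → ℝ, (∀ T, |s T| = |T|) → Tendsto (fun T : ℝ =>
      ∫ x : ℝ in (0 : ℝ)..1, k (x + (s T : ℝ) * Complex.I)) atTop (𝓝 0) := by
    intro s hs
    refine squeeze_zero_norm' (a := fun T => 2 * B / T) ?_ (Tendsto.const_div_atTop tendsto_id _)
    filter_upwards [eventually_gt_atTop 0] with T hT
    have hb : ∀ x ∈ uIoc (0 : ℝ) 1, ‖k (x + (s T : ℝ) * Complex.I)‖ ≤ 2 * B / T := by
      intro x hx
      rw [uIoc_of_le zero_le_one] at hx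
      have hle : T ≤ ‖(x : ℂ) + (s T : ℝ) * Complex.I - θ‖ := by
        have := Complex.abs_im_le_norm ((x : ℂ) + (s T : ℝ) * Complex.I - θ)
        simp only [Complex.sub_im, Complex.add_im, Complex.ofReal_im, Complex.mul_im,
          Complex.ofReal_re, Complex.I_im, mul_one, Complex.I_re, mul_zero, add_zero, zero_add,
          sub_zero, hs, abs_of_pos hT] at this
        exact this
      rw [hk_ne _ (fun h => by rw [h, sub_self, norm_zero] at hle; linarith), norm_smul, norm_inv,
        inv_mul_eq_div]
      refine div_le_div₀ ?_ ?_ hT hle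
      · have := (norm_nonneg _).trans (hB θ (by simpa using hθ0.le) (by simpa using hθ1.le))
        linarith
      · refine (norm_sub_le _ _).trans ?_
        rw [two_mul]
        refine add_le_add (hB _ ?_ ?_) (hB _ ?_ ?_)
        · simpa using hx.1.le
        · simpa using hx.2
        · simpa using hθ0.le
        · simpa using hθ1.le
    simpa using intervalIntegral.norm_integral_le_of_norm_le_const hb
  have hV1 := intervalIntegral_tendsto_integral
    (integrable_inv_smul (b := 1 - θ) (by linarith) hI1) tendsto_neg_atTop_atBot tendsto_id
  have hV0 := intervalIntegral_tendsto_integral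
    (integrable_inv_smul (b := -θ) (by linarith) hI0) tendsto_neg_atTop_atBot tendsto_id
  have ha1 := (tendsto_two_mul_arctan_div (b := 1 - θ) (by linarith)).smul_const (g θ)
  have ha0 : Tendsto (fun T : ℝ => ((2 * Real.arctan (T / (-θ)) : ℝ) : ℂ) • g θ) atTop
      (𝓝 ((-(Real.pi : ℂ)) • g θ)) := by
    refine Tendsto.smul_const ?_ _
    refine (tendsto_two_mul_arctan_div hθ0).neg.congr fun T => ?_
    rw [div_neg, Real.arctan_neg]
    push_cast
    ring
  have hlim := (((hhor (fun T => -T) (fun T => abs_neg T)).sub (hhor (fun T => T) fun T => rfl)).add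
    ((hV1.sub ha1).const_smul Complex.I)).sub ((hV0.sub ha0).const_smul Complex.I)
  have hz := tendsto_nhds_unique hlim (tendsto_const_nhds.congr' (by
    filter_upwards [eventually_gt_atTop 0] with T hT using (hrect T hT).symm))
  rw [sub_zero, zero_add, ← smul_sub] at hz
  have hz := (smul_eq_zero.1 hz).resolve_left Complex.I_ne_zero
  simp only [Complex.ofReal_zero, Complex.ofReal_one, zero_add] at hz
  have e : (2 * Real.pi : ℂ) • g θ = (Real.pi : ℂ) • g θ + (Real.pi : ℂ) • g θ := by module
  rw [e, ← sub_eq_zero, ← neg_eq_zero, ← hz]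
  module

end Cauchy

/-! ### Growth in vertical strips -/

section Growth

theorem norm_sin_le_exp (w : ℂ) : ‖Complex.sin w‖ ≤ Real.exp |w.im| := by
  have h1 : ‖Complex.exp (-w * Complex.I)‖ ≤ Real.exp |w.im| := by
    rw [Complex.norm_exp]
    gcongr
    simpa using le_abs_self _
  have h2 : ‖Complex.exp (w * Complex.I)‖ ≤ Real.exp |w.im| := by
    rw [Complex.norm_exp]
    gcongr
    simpa using neg_le_abs _
  rw [Complex.sin, norm_div, norm_mul, Complex.norm_I, mul_one, Complex.norm_two]
  have := norm_sub_le (Complex.exp (-w * Complex.I)) (Complex.exp (w * Complex.I))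
  linarith

/-- By the reflection formula `powCoeff z = sin (π z) / (π z)`, which gives the growth for `|Im z| ≥
1`; the rest of the strip is compact. -/
theorem exists_norm_powCoeff_le :
    ∃ C : ℝ, 0 ≤ C ∧ ∀ z : ℂ, |z.re| ≤ 1 / 2 → ‖powCoeff z‖ ≤ C * Real.exp (Real.pi * |z.im|) := by
  have hK : IsCompact (Icc (-(1 / 2) : ℝ) (1 / 2) ×ℂ Icc (-1 : ℝ) 1) :=
    isCompact_Icc.reProdIm isCompact_Icc
  obtain ⟨C, hC⟩ := hK.exists_bound_of_continuousOn
    IsResolventFamily.differentiable_powCoeff.continuous.continuousOn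
  refine ⟨max C 1, by positivity, fun z hz => ?_⟩
  have he : 1 ≤ Real.exp (Real.pi * |z.im|) := Real.one_le_exp (by positivity)
  rcases le_total |z.im| 1 with h | h
  · calc ‖powCoeff z‖ ≤ C := hC z ⟨abs_le.1 hz, abs_le.1 h⟩
      _ ≤ max C 1 * 1 := by rw [mul_one]; exact le_max_left _ _
      _ ≤ _ := by gcongr
  · have hz1 : 1 ≤ ‖z‖ := h.trans (Complex.abs_im_le_norm z)
    have hz0 : z ≠ 0 := fun h => by simp [h] at hz1; linarith
    have e : powCoeff z = Complex.sin (Real.pi * z) / (Real.pi * z) := by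
      rw [powCoeff, ← mul_inv, add_comm, Complex.Gamma_add_one z hz0, mul_assoc,
        Complex.Gamma_mul_Gamma_one_sub]
      field_simp
    rw [e, norm_div]
    have h2 : 1 ≤ ‖(Real.pi * z : ℂ)‖ := by
      rw [norm_mul, Complex.norm_real, Real.norm_of_nonneg Real.pi_pos.le]
      nlinarith [Real.pi_gt_three]
    calc ‖Complex.sin (Real.pi * z)‖ / ‖(Real.pi * z : ℂ)‖ ≤ ‖Complex.sin (Real.pi * z)‖ :=
          div_le_self (norm_nonneg _) h2
      _ ≤ Real.exp |(Real.pi * z : ℂ).im| := norm_sin_le_exp _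
      _ = 1 * Real.exp (Real.pi * |z.im|) := by
          rw [Complex.im_ofReal_mul, abs_mul, abs_of_pos Real.pi_pos, one_mul]
      _ ≤ _ := by gcongr; exact le_max_right _ _

/-- The Gaussian factor `exp ((z - θ) ^ 2)`. -/
def gaussFactor (θ : ℝ) (z : ℂ) : ℂ := Complex.exp ((z - θ) ^ 2)

theorem differentiable_gaussFactor (θ : ℝ) : Differentiable ℂ (gaussFactor θ) := by
  unfold gaussFactor
  fun_prop

theorem gaussFactor_self (θ : ℝ) : gaussFactor θ θ = 1 := by simp [gaussFactor]

theorem norm_gaussFactor_le {θ : ℝ} (hθ : θ ∈ Ioo (0 : ℝ) 1) {z : ℂ} (h0 : 0 ≤ z.re)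
    (h1 : z.re ≤ 1) : ‖gaussFactor θ z‖ ≤ Real.exp (1 - z.im ^ 2) := by
  obtain ⟨hθ0, hθ1⟩ := hθ
  rw [gaussFactor, Complex.norm_exp]
  gcongr
  have : ((z - θ) ^ 2).re = (z.re - θ) ^ 2 - z.im ^ 2 := by
    rw [sq]
    simp
    ring
  rw [this]
  nlinarith

variable {X : Type*} [NormedAddCommGroup X] [NormedSpace ℂ X] {S : ℝ → X →L[ℂ] X} {L : ℝ}

/-- The bounded operator `A ^ (z - 2)` for `-1 < Re z < 2`. -/
def powSubTwo (S : ℝ → X →L[ℂ] X) (z : ℂ) : X →L[ℂ] X :=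
  if z.re < 1 / 2 then S 0 * powSubOne S z else powSubOne S (z - 1)

namespace IsResolventFamily

/-- For `|Re z| ≤ 1 / 2` one has `|t ^ z| ≤ t ^ (-1 / 2) + t ^ (1 / 2)`, so the integral is bounded
uniformly and the growth is that of `powCoeff`. -/
theorem exists_norm_powSubOne_le (hS : IsResolventFamily S L) :
    ∃ C : ℝ, 0 ≤ C ∧ ∀ z : ℂ, |z.re| ≤ 1 / 2 → ‖powSubOne S z‖ ≤ C * Real.exp (Real.pi * |z.im|) := by
  obtain ⟨C, hC0, hC⟩ := exists_norm_powCoeff_le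
  have hi1 := integrableOn_rpow_div_pow (x := -(1 / 2)) (n := 2) (by norm_num) (by norm_num)
  have hi2 := integrableOn_rpow_div_pow (x := 1 / 2) (n := 2) (by norm_num) (by norm_num)
  set D := ∫ t in Ioi (0 : ℝ), L ^ 2 *
    (t ^ (-(1 / 2) : ℝ) / (1 + t) ^ 2 + t ^ (1 / 2 : ℝ) / (1 + t) ^ 2) with hD
  have hI : ∀ z : ℂ, |z.re| ≤ 1 / 2 → ‖powIntegral S z‖ ≤ D := by
    intro z hz
    obtain ⟨hz1, hz2⟩ := abs_le.1 hz
    refine norm_integral_le_of_norm_le ((hi1.add hi2).const_mul _) ?_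
    filter_upwards [ae_restrict_mem measurableSet_Ioi] with t ht
    have ht : 0 < t := ht
    have h := hS.norm_cpow_smul_sq_shift_le z le_rfl ht
    rw [zero_add] at h
    refine h.trans ?_
    rw [← add_div]
    gcongr
    rcases le_total t 1 with h1 | h1
    · have := Real.rpow_le_rpow_of_exponent_ge ht h1 hz1
      have : 0 ≤ t ^ (1 / 2 : ℝ) := by positivity
      linarith
    · have := Real.rpow_le_rpow_of_exponent_le h1 hz2
      have : 0 ≤ t ^ (-(1 / 2) : ℝ) := by positivity
      linarith
  have hD0 : 0 ≤ D := (norm_nonneg _).trans (hI 0 (by simp))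
  refine ⟨C * D, by positivity, fun z hz => ?_⟩
  rw [powSubOne, norm_smul]
  calc ‖powCoeff z‖ * ‖powIntegral S z‖ ≤ C * Real.exp (Real.pi * |z.im|) * D :=
        mul_le_mul (hC z hz) (hI z hz) (norm_nonneg _) (by positivity)
    _ = _ := by ring

/-- The two branches agree for `0 < Re z < 1` by `mul_powSubOne`, so the cut at `1 / 2` is
invisible. Its position lets `exists_norm_powSubOne_le` cover both branches on `0 ≤ Re z ≤ 1`. -/
theorem powSubTwo_eq_left [CompleteSpace X] (hS : IsResolventFamily S L) {z : ℂ} (h1 : z.re < 1) :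
    powSubTwo S z = S 0 * powSubOne S z := by
  rw [powSubTwo]
  split_ifs with h
  · rfl
  · rw [hS.mul_powSubOne (by linarith) h1]

theorem powSubTwo_eq_right [CompleteSpace X] (hS : IsResolventFamily S L) {z : ℂ} (h0 : 0 < z.re) :
    powSubTwo S z = powSubOne S (z - 1) := by
  rw [powSubTwo]
  split_ifs with h
  · rw [hS.mul_powSubOne h0 (by linarith)]
  · rfl

theorem differentiableAt_powSubTwo [CompleteSpace X] (hS : IsResolventFamily S L) {z : ℂ}
    (h0 : -1 < z.re) (h1 : z.re < 2) : DifferentiableAt ℂ (powSubTwo S) z := by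
  rcases lt_or_ge z.re 1 with h | h
  · have hd : DifferentiableAt ℂ (fun z => S 0 * powSubOne S z) z :=
      (hS.differentiableAt_powSubOne h0 h).const_mul (S 0)
    refine hd.congr_of_eventuallyEq ?_
    filter_upwards [(isOpen_lt Complex.continuous_re continuous_const).mem_nhds h] with w hw
    exact hS.powSubTwo_eq_left hw
  · have hd : DifferentiableAt ℂ (fun z => powSubOne S (z - 1)) z :=
      DifferentiableAt.fun_comp' z
        (hS.differentiableAt_powSubOne (z := z - 1) (by simp; linarith) (by simp; linarith))
        (by fun_prop : DifferentiableAt ℂ (fun z : ℂ => z - 1) z)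
    refine hd.congr_of_eventuallyEq ?_
    filter_upwards [(isOpen_lt continuous_const Complex.continuous_re).mem_nhds
      (by linarith : 0 < z.re)] with w hw
    exact hS.powSubTwo_eq_right hw

/-- The Gaussian decay beats `exp (π |Im w|)`. Two variables are needed because the lemma is used
with `w = z` and with `w = 1 - z`. The bound depends on the operator and is used only qualitatively.
-/
theorem exists_norm_gaussFactor_smul_powSubTwo_le (hS : IsResolventFamily S L) {θ : ℝ}
    (hθ : θ ∈ Ioo (0 : ℝ) 1) : ∃ K : ℝ, 0 ≤ K ∧ ∀ z w : ℂ, 0 ≤ z.re → z.re ≤ 1 → 0 ≤ w.re →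
      w.re ≤ 1 → |w.im| = |z.im| → ‖gaussFactor θ z • powSubTwo S w‖ ≤ K := by
  obtain ⟨C, hC0, hC⟩ := hS.exists_norm_powSubOne_le
  have hL := hS.nonneg
  refine ⟨Real.exp (1 + Real.pi ^ 2) * ((1 + L) * C), by positivity, ?_⟩
  intro z w h0 h1 hw0 hw1 him
  have hw : ‖powSubTwo S w‖ ≤ (1 + L) * (C * Real.exp (Real.pi * |w.im|)) := by
    rw [powSubTwo]
    split_ifs with h
    · refine (norm_mul_le _ _).trans (mul_le_mul ?_ (hC w (abs_le.2 ⟨by linarith, h.le⟩))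
        (norm_nonneg _) (by positivity))
      linarith [hS.norm_le le_rfl]
    · have := hC (w - 1) (abs_le.2 ⟨by simp; linarith, by simp; linarith⟩)
      rw [Complex.sub_im, Complex.one_im, sub_zero] at this
      refine this.trans (le_mul_of_one_le_left (by positivity) (by linarith))
  rw [norm_smul]
  calc ‖gaussFactor θ z‖ * ‖powSubTwo S w‖
      ≤ Real.exp (1 - z.im ^ 2) * ((1 + L) * (C * Real.exp (Real.pi * |w.im|))) :=
        mul_le_mul (norm_gaussFactor_le hθ h0 h1) hw (norm_nonneg _) (by positivity)
    _ = Real.exp (1 - z.im ^ 2 + Real.pi * |z.im|) * ((1 + L) * C) := by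
        rw [Real.exp_add, him]
        ring
    _ ≤ _ := by
        refine mul_le_mul_of_nonneg_right (Real.exp_le_exp.2 ?_) (by positivity)
        rw [← sq_abs z.im]
        nlinarith [sq_nonneg (|z.im| - Real.pi / 2), sq_nonneg Real.pi]

end IsResolventFamily

end Growth

/-! ### Strong continuity -/

section Strong

variable {X : Type*} [NormedAddCommGroup X] [NormedSpace ℂ X]

/-- An `ε / 3` argument: a uniform bound extends strong convergence from a dense range to all
vectors, even varying ones. -/
theorem tendsto_apply_of_denseRange {ι : Type*} {l : Filter ι} {T : ι → X →L[ℂ] X}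
    {T₀ P : X →L[ℂ] X} {C : ℝ} (hP : DenseRange P) (hb : ∀ᶠ i in l, ‖T i‖ ≤ C)
    (hT : ∀ u, Tendsto (fun i => T i (P u)) l (𝓝 (T₀ (P u)))) {v : ι → X} {v₀ : X}
    (hv : Tendsto v l (𝓝 v₀)) : Tendsto (fun i => T i (v i)) l (𝓝 (T₀ v₀)) := by
  rw [Metric.tendsto_nhds]
  intro ε hε
  have hK : 0 < |C| + ‖T₀‖ + 1 := by positivity
  obtain ⟨u, hu⟩ := hP.exists_dist_lt v₀ (ε := ε / (3 * (|C| + ‖T₀‖ + 1))) (by positivity)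
  rw [dist_eq_norm, lt_div_iff₀ (by positivity)] at hu
  filter_upwards [hb, Metric.tendsto_nhds.1 (hT u) (ε / 3) (by positivity),
    Metric.tendsto_nhds.1 hv (ε / (3 * (|C| + ‖T₀‖ + 1))) (by positivity)] with i hi h1 h2
  rw [dist_eq_norm] at h1 h2 ⊢
  rw [lt_div_iff₀ (by positivity)] at h2
  have hi : ‖T i‖ ≤ |C| := hi.trans (le_abs_self C)
  have e : T i (v i) - T₀ v₀ = T i (v i - v₀) + T i (v₀ - P u) + (T i (P u) - T₀ (P u)) -
      T₀ (v₀ - P u) := by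
    simp only [map_sub]
    abel
  have b1 := (T i).le_of_opNorm_le hi (v i - v₀)
  have b2 := (T i).le_of_opNorm_le hi (v₀ - P u)
  have b3 := T₀.le_opNorm (v₀ - P u)
  rw [e]
  have n1 := norm_sub_le (T i (v i - v₀) + T i (v₀ - P u) + (T i (P u) - T₀ (P u))) (T₀ (v₀ - P u))
  have n2 := norm_add₃_le (a := T i (v i - v₀)) (b := T i (v₀ - P u)) (c := (T i (P u) - T₀ (P u)))
  have c1 : |C| * ‖v i - v₀‖ < ε / 3 := by
    nlinarith [norm_nonneg (v i - v₀), norm_nonneg T₀]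
  have c2 : |C| * ‖v₀ - P u‖ + ‖T₀‖ * ‖v₀ - P u‖ < ε / 3 := by
    nlinarith [norm_nonneg (v₀ - P u), norm_nonneg T₀]
  linarith

end Strong

/-! ### From functions on the strip to the domain of `A ^ θ` -/

section Strip

variable {X : Type*} [NormedAddCommGroup X] [NormedSpace ℂ X]
  {S : ℝ → X →L[ℂ] X} {L : ℝ} {U : ℝ → X →L[ℂ] X} {M ω θ : ℝ}

/-- The operators `U t` behave like the imaginary powers `A ^ (i t)`. -/
structure IsImaginaryPowers (S U : ℝ → X →L[ℂ] X) (M ω : ℝ) : Prop where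
  powSubOne_eq : ∀ t : ℝ, powSubOne S (t * Complex.I) = S 0 * U t
  bound : ∀ t, ‖U t‖ ≤ M * Real.exp (ω * |t|)

namespace IsImaginaryPowers

theorem nonneg (hU : IsImaginaryPowers S U M ω) : 0 ≤ M := by
  simpa using (norm_nonneg _).trans (hU.bound 0)

/-- `A⁻¹` commutes with `A ^ (it - 1) = A⁻¹ U t`; the leading `A⁻¹` is then cancelled by
injectivity. -/
theorem commute [CompleteSpace X] (hS : IsResolventFamily S L) (hinj : Function.Injective (S 0))
    (hU : IsImaginaryPowers S U M ω) (t : ℝ) : S 0 * U t = U t * S 0 := by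
  have hc : Commute (S 0) (powSubOne S (t * Complex.I)) :=
    commute_powSubOne _ fun t ht => hS.comm le_rfl ht.le
  have h := hc.eq
  rw [hU.powSubOne_eq, mul_assoc (S 0) (U t)] at h
  ext x
  exact hinj (congrArg (fun T : X →L[ℂ] X => T x) h)

/-- On the dense range of `A⁻¹` the orbits are those of `A ^ (it - 1)`, which is norm continuous in
`t`; the local bound on `‖U t‖` does the rest. -/
theorem continuous_apply [CompleteSpace X] (hS : IsResolventFamily S L)
    (hinj : Function.Injective (S 0)) (hdense : DenseRange (S 0))
    (hU : IsImaginaryPowers S U M ω) {a : ℝ → ℝ} (ha : Continuous a) {v : ℝ → X}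
    (hv : Continuous v) : Continuous fun t => U (a t) (v t) := by
  refine continuous_iff_continuousAt.2 fun t₀ => ?_
  have hb : Continuous fun t => M * Real.exp (ω * |a t|) := by fun_prop
  refine tendsto_apply_of_denseRange (C := M * Real.exp (ω * |a t₀|) + 1) hdense ?_ ?_
    (hv.tendsto t₀)
  · filter_upwards [(hb.tendsto t₀).eventually_lt_const (lt_add_one _)] with t ht
    exact (hU.bound _).trans ht.le
  · intro u
    have e : ∀ t, U (a t) (S 0 u) = powSubOne S (a t * Complex.I) u := fun t => by
      rw [hU.powSubOne_eq, hU.commute hS hinj]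
      rfl
    simp_rw [e]
    have hc : ContinuousAt (fun t => powSubOne S (a t * Complex.I)) t₀ :=
      ContinuousAt.comp (f := fun t => (a t : ℂ) * Complex.I) (g := powSubOne S)
        (hS.differentiableAt_powSubOne (by simp) (by simp)).continuousAt
        (by fun_prop : Continuous fun t => (a t : ℂ) * Complex.I).continuousAt
    exact ((ContinuousLinearMap.apply ℂ X u).continuous.tendsto _).comp hc

theorem powSubTwo_left [CompleteSpace X] (hS : IsResolventFamily S L)
    (hU : IsImaginaryPowers S U M ω) (t : ℝ) :
    powSubTwo S (t * Complex.I) = S 0 * (S 0 * U t) := by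
  rw [hS.powSubTwo_eq_left (by simp), hU.powSubOne_eq]

theorem powSubTwo_right [CompleteSpace X] (hS : IsResolventFamily S L)
    (hU : IsImaginaryPowers S U M ω) (t : ℝ) :
    powSubTwo S (1 + t * Complex.I) = S 0 * U t := by
  rw [hS.powSubTwo_eq_right (by simp), add_sub_cancel_left, hU.powSubOne_eq]

theorem norm_gaussFactor_smul_le (hU : IsImaginaryPowers S U M ω) (hθ : θ ∈ Ioo (0 : ℝ) 1) {z : ℂ}
    (h0 : 0 ≤ z.re) (h1 : z.re ≤ 1) {t : ℝ} (ht : |t| = |z.im|) (x : X) :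
    ‖gaussFactor θ z • U t x‖ ≤ M * Real.exp (1 - z.im ^ 2 + ω * |z.im|) * ‖x‖ := by
  have hM := hU.nonneg
  rw [norm_smul]
  calc ‖gaussFactor θ z‖ * ‖U t x‖
      ≤ Real.exp (1 - z.im ^ 2) * (M * Real.exp (ω * |t|) * ‖x‖) :=
        mul_le_mul (norm_gaussFactor_le hθ h0 h1) ((U t).le_of_opNorm_le (hU.bound t) x)
          (norm_nonneg _) (by positivity)
    _ = _ := by
        rw [ht, Real.exp_add]
        ring

end IsImaginaryPowers

theorem exp_gauss_le (ω y : ℝ) :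
    Real.exp (1 - y ^ 2 + ω * |y|) ≤ Real.exp (1 + ω ^ 2) * Real.exp (-(1 / 2) * y ^ 2) := by
  rw [← Real.exp_add]
  refine Real.exp_le_exp.2 ?_
  rw [← sq_abs y]
  nlinarith [sq_nonneg (|y| - ω)]

theorem integrable_exp_gauss (ω : ℝ) : Integrable fun y : ℝ => Real.exp (1 - y ^ 2 + ω * |y|) := by
  refine ((integrable_exp_neg_mul_sq (by norm_num : (0 : ℝ) < 1 / 2)).const_mul
    (Real.exp (1 + ω ^ 2))).mono' (Continuous.aestronglyMeasurable (by fun_prop)) ?_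
  refine Eventually.of_forall fun y => ?_
  rw [Real.norm_of_nonneg (Real.exp_pos _).le]
  exact exp_gauss_le ω y

theorem exp_gauss_le_const (ω y : ℝ) :
    Real.exp (1 - y ^ 2 + ω * |y|) ≤ Real.exp (1 + ω ^ 2) :=
  (exp_gauss_le ω y).trans (mul_le_of_le_one_right (Real.exp_pos _).le
    (Real.exp_le_one_iff.2 (by nlinarith [sq_nonneg y])))

/-- The constant in the embedding of the interpolation space in the domain of `A ^ θ`. -/
def embeddingConst (M ω θ : ℝ) : ℝ :=
  (2 * Real.pi)⁻¹ * (((1 - θ)⁻¹ + θ⁻¹) * (M * ∫ y : ℝ, Real.exp (1 - y ^ 2 + ω * |y|)))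

theorem norm_integral_inv_smul_le {w : ℝ → X} {b C : ℝ} (hb : b ≠ 0)
    (hw : ∀ t, ‖w t‖ ≤ C * Real.exp (1 - t ^ 2 + ω * |t|)) :
    ‖∫ t : ℝ, ((b : ℂ) + t * Complex.I)⁻¹ • w t‖ ≤
      |b|⁻¹ * (C * ∫ y : ℝ, Real.exp (1 - y ^ 2 + ω * |y|)) := by
  rw [← integral_const_mul, ← integral_const_mul]
  refine norm_integral_le_of_norm_le (((integrable_exp_gauss ω).const_mul _).const_mul _)
    (Eventually.of_forall fun t => ?_)
  rw [norm_smul]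
  exact mul_le_mul (norm_inv_add_mul_I_le hb t) (hw t) (norm_nonneg _) (by positivity)

/-- Values at `θ` of functions on the strip belong to the domain of `A ^ θ`. -/
theorem exists_powSubOne_eq_of_strip [CompleteSpace X] (hS : IsResolventFamily S L)
    (hinj : Function.Injective (S 0)) (hdense : DenseRange (S 0))
    (hU : IsImaginaryPowers S U M ω) (hθ : θ ∈ Ioo (0 : ℝ) 1) {f : ℂ → X} {l r : ℝ → X} {B N : ℝ}
    (hc : ContinuousOn f {z | 0 ≤ z.re ∧ z.re ≤ 1})
    (hd : DifferentiableOn ℂ f {z | 0 < z.re ∧ z.re < 1})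
    (hB : ∀ z : ℂ, 0 ≤ z.re → z.re ≤ 1 → ‖f z‖ ≤ B)
    (hl : Continuous l) (hr : Continuous r) (hlN : ∀ t, ‖l t‖ ≤ N) (hrN : ∀ t, ‖r t‖ ≤ N)
    (hfl : ∀ t : ℝ, f (t * Complex.I) = l t) (hfr : ∀ t : ℝ, f (1 + t * Complex.I) = S 0 (r t)) :
    ∃ y : X, powSubOne S θ (f θ) = S 0 y ∧ ‖y‖ ≤ embeddingConst M ω θ * N := by
  obtain ⟨K, hK0, hK⟩ := hS.exists_norm_gaussFactor_smul_powSubTwo_le hθ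
  obtain ⟨hθ0, hθ1⟩ := id hθ
  have hM := hU.nonneg
  have hN : 0 ≤ N := (norm_nonneg _).trans (hlN 0)
  -- The role of `g` is that of `exp ((z - θ) ^ 2) A ^ (z - 2) f(z)`, bounded and holomorphic
  -- whether or not `A ^ z f(z)` is defined.
  set g : ℂ → X := fun z => (gaussFactor θ z • powSubTwo S z) (f z) with hg
  have hTd : ∀ z : ℂ, 0 ≤ z.re → z.re ≤ 1 →
      DifferentiableAt ℂ (fun z => gaussFactor θ z • powSubTwo S z) z := fun z h0 h1 =>
    (differentiable_gaussFactor θ z).smul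
      (hS.differentiableAt_powSubTwo (by linarith) (by linarith))
  have hgc : ContinuousOn g {z | 0 ≤ z.re ∧ z.re ≤ 1} :=
    ContinuousOn.clm_apply (fun z hz => (hTd z hz.1 hz.2).continuousAt.continuousWithinAt) hc
  have hgd : DifferentiableOn ℂ g {z | 0 < z.re ∧ z.re < 1} :=
    DifferentiableOn.clm_apply
      (fun z hz => (hTd z hz.1.le hz.2.le).differentiableWithinAt) hd
  have hgB : ∀ z : ℂ, 0 ≤ z.re → z.re ≤ 1 → ‖g z‖ ≤ K * B := fun z h0 h1 =>
    (ContinuousLinearMap.le_of_opNorm_le _ (hK z z h0 h1 h0 h1 rfl) _).trans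
      (mul_le_mul_of_nonneg_left (hB z h0 h1) hK0)
  set w0 : ℝ → X := fun t => gaussFactor θ (t * Complex.I) • U t (l t) with hw0
  set w1 : ℝ → X := fun t => gaussFactor θ (1 + t * Complex.I) • U t (r t) with hw1
  have hgaussc := (differentiable_gaussFactor θ).continuous
  have hw0c : Continuous w0 := (hgaussc.comp (by fun_prop)).smul
    (hU.continuous_apply hS hinj hdense continuous_id hl)
  have hw1c : Continuous w1 := (hgaussc.comp (by fun_prop)).smul
    (hU.continuous_apply hS hinj hdense continuous_id hr)
  have hw0b : ∀ t, ‖w0 t‖ ≤ M * N * Real.exp (1 - t ^ 2 + ω * |t|) := fun t => by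
    refine (hU.norm_gaussFactor_smul_le hθ (by simp) (by simp) (by simp) _).trans ?_
    have : ((t : ℂ) * Complex.I).im = t := by simp
    rw [this, mul_right_comm]
    gcongr
    exact hlN t
  have hw1b : ∀ t, ‖w1 t‖ ≤ M * N * Real.exp (1 - t ^ 2 + ω * |t|) := fun t => by
    refine (hU.norm_gaussFactor_smul_le hθ (by simp) (by simp) (by simp) _).trans ?_
    have : (1 + (t : ℂ) * Complex.I).im = t := by simp
    rw [this, mul_right_comm]
    gcongr
    exact hrN t
  have hw0i : Integrable w0 := ((integrable_exp_gauss ω).const_mul (M * N)).mono'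
    hw0c.aestronglyMeasurable (Eventually.of_forall hw0b)
  have hw1i : Integrable w1 := ((integrable_exp_gauss ω).const_mul (M * N)).mono'
    hw1c.aestronglyMeasurable (Eventually.of_forall hw1b)
  have hg0 : ∀ t : ℝ, g (t * Complex.I) = (S 0 * S 0) (w0 t) := fun t => by
    simp only [hg, hw0, hfl, hU.powSubTwo_left hS, map_smul]
    rfl
  -- On this line `A ^ (z - 2)` yields only one `A⁻¹`; the other comes from `f (1 + it) = A⁻¹ r(t)`.
  have hg1 : ∀ t : ℝ, g (1 + t * Complex.I) = (S 0 * S 0) (w1 t) := fun t => by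
    simp only [hg, hw1, hfr, hU.powSubTwo_right hS, map_smul]
    have e : (S 0 * U t) (S 0 (r t)) = (S 0 * (U t * S 0)) (r t) := rfl
    rw [smul_apply, e, ← hU.commute hS hinj]
    rfl
  have hcauchy := two_pi_smul_eq_integral_strip hθ hgc hgd hgB
    (by simp_rw [hg0]; exact (S 0 * S 0).integrable_comp hw0i)
    (by simp_rw [hg1]; exact (S 0 * S 0).integrable_comp hw1i)
  simp_rw [hg0, hg1, ← map_smul] at hcauchy
  have hb1 : (1 - θ) ≠ 0 := by linarith
  have hb0 : -θ ≠ 0 := by linarith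
  rw [ContinuousLinearMap.integral_comp_comm _ (integrable_inv_smul hb1 hw1i),
    ContinuousLinearMap.integral_comp_comm _ (integrable_inv_smul hb0 hw0i), ← map_sub] at hcauchy
  have n1 := norm_integral_inv_smul_le hb1 hw1b
  have n0 := norm_integral_inv_smul_le hb0 hw0b
  set I1 := ∫ t : ℝ, (((1 - θ : ℝ) : ℂ) + t * Complex.I)⁻¹ • w1 t
  set I0 := ∫ t : ℝ, (((-θ : ℝ) : ℂ) + t * Complex.I)⁻¹ • w0 t
  have hpi : (2 * Real.pi : ℂ) ≠ 0 := by
    exact_mod_cast (by positivity : (2 * Real.pi : ℝ) ≠ 0)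
  -- After `A⁻²` is taken out of the Cauchy formula, `A ^ (θ - 2) f(θ) = A⁻² y` with this `y`; one
  -- `A⁻¹` is cancelled.
  refine ⟨(2 * Real.pi : ℂ)⁻¹ • (I1 - I0), hinj ?_, ?_⟩
  · have e : g θ = S 0 (powSubOne S θ (f θ)) := by
      simp only [hg, gaussFactor_self, one_smul]
      rw [hS.powSubTwo_eq_left (by simpa using hθ1)]
      rfl
    rw [← e, map_smul, map_smul]
    have e2 : (S 0 * S 0) (I1 - I0) = S 0 (S 0 (I1 - I0)) := rfl
    rw [← e2, ← hcauchy, smul_smul, inv_mul_cancel₀ hpi, one_smul]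
  · rw [norm_smul, norm_inv, norm_mul, Complex.norm_real, Complex.norm_two,
      Real.norm_of_nonneg Real.pi_pos.le, embeddingConst, mul_assoc]
    refine mul_le_mul_of_nonneg_left ?_ (by positivity)
    rw [abs_of_pos (by linarith : 0 < 1 - θ)] at n1
    rw [abs_neg, abs_of_pos hθ0] at n0
    refine (norm_sub_le _ _).trans ((add_le_add n1 n0).trans (le_of_eq ?_))
    ring

end Strip

/-! ### From the domain of `A ^ θ` to functions on the strip -/

section Strip

variable {X : Type*} [NormedAddCommGroup X] [NormedSpace ℂ X]
  {S : ℝ → X →L[ℂ] X} {L : ℝ} {U : ℝ → X →L[ℂ] X} {M ω θ : ℝ}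

/-- The function `z ↦ exp ((z - θ) ^ 2) A ^ (-z - 1) u`. -/
def stripOrbit (S : ℝ → X →L[ℂ] X) (θ : ℝ) (u : X) (z : ℂ) : X :=
  (gaussFactor θ z • powSubTwo S (1 - z)) u

theorem stripOrbit_sub (u v : X) (z : ℂ) :
    stripOrbit S θ (u - v) z = stripOrbit S θ u z - stripOrbit S θ v z := map_sub _ _ _

section

variable [CompleteSpace X] (hS : IsResolventFamily S L)
  (hinj : Function.Injective (S 0)) (hU : IsImaginaryPowers S U M ω) (hθ : θ ∈ Ioo (0 : ℝ) 1)

include hS in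
theorem differentiableAt_stripOrbit (u : X) {z : ℂ} (h0 : 0 ≤ z.re) (h1 : z.re ≤ 1) :
    DifferentiableAt ℂ (stripOrbit S θ u) z := by
  have hT : DifferentiableAt ℂ (fun z => gaussFactor θ z • powSubTwo S (1 - z)) z :=
    (differentiable_gaussFactor θ z).smul (DifferentiableAt.fun_comp' z
      (hS.differentiableAt_powSubTwo (z := 1 - z) (by simp; linarith) (by simp; linarith))
      (by fun_prop : DifferentiableAt ℂ (fun z : ℂ => 1 - z) z))
  exact hT.clm_apply (differentiableAt_const u)

include hS hinj hU in
theorem stripOrbit_left (u : X) (t : ℝ) : stripOrbit S θ u (t * Complex.I) =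
    gaussFactor θ (t * Complex.I) • U (-t) (S 0 u) := by
  have e : (1 : ℂ) - t * Complex.I = 1 + ((-t : ℝ) : ℂ) * Complex.I := by push_cast; ring
  rw [stripOrbit, e, hU.powSubTwo_right hS, hU.commute hS hinj]
  rfl

include hS hinj hU in
theorem stripOrbit_right (u : X) (t : ℝ) : stripOrbit S θ u (1 + t * Complex.I) =
    S 0 (gaussFactor θ (1 + t * Complex.I) • U (-t) (S 0 u)) := by
  have e : (1 : ℂ) - (1 + t * Complex.I) = ((-t : ℝ) : ℂ) * Complex.I := by push_cast; ring
  rw [stripOrbit, e, hU.powSubTwo_left hS, hU.commute hS hinj, map_smul]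
  rfl

/-- The bound of `exp ((z - θ) ^ 2) A ^ (-i t)` on the boundary of the strip. -/
def boundaryConst (M ω : ℝ) : ℝ := M * Real.exp (1 + ω ^ 2)

omit [CompleteSpace X] in
include hU hθ in
theorem norm_boundary_le {z : ℂ} (h0 : 0 ≤ z.re) (h1 : z.re ≤ 1) (y : X) :
    ‖gaussFactor θ z • U (-z.im) y‖ ≤ boundaryConst M ω * ‖y‖ := by
  have hM := hU.nonneg
  refine (hU.norm_gaussFactor_smul_le hθ h0 h1 (abs_neg _) y).trans ?_
  rw [boundaryConst]
  exact mul_le_mul_of_nonneg_right (mul_le_mul_of_nonneg_left (exp_gauss_le_const ω z.im) hM)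
    (norm_nonneg _)

include hS hinj hU hθ in
-- The point is a bound by `‖A⁻¹ u‖` rather than `‖u‖`. The boundary values involve `u` only through
-- `A⁻¹ u`, and the Phragmén-Lindelöf principle carries the bound inside. The factor `1 + L` serves
-- both lines, the right one having an extra `A⁻¹`.
theorem norm_stripOrbit_le (u : X) {z : ℂ} (h0 : 0 ≤ z.re) (h1 : z.re ≤ 1) :
    ‖stripOrbit S θ u z‖ ≤ (1 + L) * (boundaryConst M ω * ‖S 0 u‖) := by
  have hL := hS.nonneg
  have hM := hU.nonneg
  have hb0 : 0 ≤ boundaryConst M ω * ‖S 0 u‖ := by unfold boundaryConst; positivity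
  obtain ⟨K, hK0, hK⟩ := hS.exists_norm_gaussFactor_smul_powSubTwo_le hθ
  -- The orbit is bounded by `K * ‖u‖` in the strip, so the growth condition holds with exponent
  -- `0`.
  refine PhragmenLindelof.vertical_strip (a := 0) (b := 1) ?_ ⟨0, by positivity, 0, ?_⟩ ?_ ?_ h0 h1
  · refine DifferentiableOn.diffContOnCl fun w hw => ?_
    rw [Complex.closure_preimage_re, closure_Ioo zero_ne_one] at hw
    exact (differentiableAt_stripOrbit hS u hw.1 hw.2).differentiableWithinAt
  · refine Asymptotics.IsBigO.of_bound (K * ‖u‖) ?_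
    refine mem_inf_of_right fun w hw => ?_
    have hw : w.re ∈ Ioo (0 : ℝ) 1 := hw
    simp only [mem_ofPred_eq, zero_mul, Real.exp_zero, norm_one, mul_one]
    exact ContinuousLinearMap.le_of_opNorm_le _ (hK w (1 - w) hw.1.le hw.2.le
      (by simpa using hw.2.le) (by simpa using hw.1.le) (by simp)) u
  · intro w hw
    have e : w = (w.im : ℝ) * Complex.I := by
      apply Complex.ext <;> simp [hw]
    rw [e, stripOrbit_left hS hinj hU, ← e]
    refine (norm_boundary_le hU hθ (by rw [hw]) (by rw [hw]; exact zero_le_one) _).trans ?_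
    exact le_mul_of_one_le_left hb0 (by linarith)
  · intro w hw
    have e : w = 1 + (w.im : ℝ) * Complex.I := by
      apply Complex.ext <;> simp [hw]
    rw [e, stripOrbit_right hS hinj hU, ← e]
    refine ((S 0).le_of_opNorm_le (hS.norm_le le_rfl) _).trans ?_
    have := norm_boundary_le hU hθ (by rw [hw]; exact zero_le_one) (by rw [hw]) (S 0 u) (z := w)
    exact mul_le_mul (by linarith) this (norm_nonneg _) (by linarith)

include hS hinj hU hθ in
/-- Elements of the domain of `A ^ θ` are values at `θ` of functions on the strip. -/
theorem exists_strip_function (hdense : DenseRange (S 0)) (y : X) :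
    ∃ F : ℂ → X, ContinuousOn F {z | 0 ≤ z.re ∧ z.re ≤ 1} ∧
      DifferentiableOn ℂ F {z | 0 < z.re ∧ z.re < 1} ∧
      (∃ B : ℝ, ∀ z : ℂ, 0 ≤ z.re → z.re ≤ 1 → ‖F z‖ ≤ B) ∧
      (∀ t : ℝ, F (t * Complex.I) = gaussFactor θ (t * Complex.I) • U (-t) y) ∧
      (∀ t : ℝ, F (1 + t * Complex.I) = S 0 (gaussFactor θ (1 + t * Complex.I) • U (-t) y)) ∧
      S 0 (F θ) = powSubOne S (-θ : ℂ) y := by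
  obtain ⟨hθ0, hθ1⟩ := id hθ
  have hL := hS.nonneg
  obtain ⟨v, hv, hvy⟩ := mem_closure_iff_seq_limit.1 (hdense y)
  choose u hu using hv
  have hSu : Tendsto (fun n => S 0 (u n)) atTop (𝓝 y) := by simpa only [hu] using hvy
  set D := (1 + L) * boundaryConst M ω with hD
  have hD0 : 0 ≤ D := by
    have := hU.nonneg
    unfold D boundaryConst
    positivity
  have hF : ∀ (w : X) {z : ℂ}, 0 ≤ z.re → z.re ≤ 1 → ‖stripOrbit S θ w z‖ ≤ D * ‖S 0 w‖ :=
    fun w z h0 h1 => by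
      rw [hD, mul_assoc]
      exact norm_stripOrbit_le hS hinj hU hθ w h0 h1
  -- The vectors `u n` may diverge, but `A⁻¹ (u n)` converges to `y`, and only this enters the bound
  -- of the orbits.
  have hC : UniformCauchySeqOn (fun n => stripOrbit S θ (u n)) atTop
      {z : ℂ | 0 ≤ z.re ∧ z.re ≤ 1} := by
    rw [Metric.uniformCauchySeqOn_iff]
    intro ε hε
    obtain ⟨n₀, hn₀⟩ := Metric.cauchySeq_iff.1 hSu.cauchySeq (ε / (D + 1)) (by positivity)
    refine ⟨n₀, fun m hm n hn z hz => ?_⟩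
    have h := hn₀ m hm n hn
    rw [dist_eq_norm, lt_div_iff₀ (by positivity), ← map_sub] at h
    rw [dist_eq_norm, ← stripOrbit_sub]
    refine (hF _ hz.1 hz.2).trans_lt ?_
    nlinarith [norm_nonneg (S 0 (u m - u n))]
  have hlim : ∀ z : ℂ, ∃ x : X, 0 ≤ z.re ∧ z.re ≤ 1 →
      Tendsto (fun n => stripOrbit S θ (u n) z) atTop (𝓝 x) := by
    intro z
    by_cases hz : 0 ≤ z.re ∧ z.re ≤ 1
    · obtain ⟨x, hx⟩ := cauchySeq_tendsto_of_complete (hC.cauchySeq hz)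
      exact ⟨x, fun _ => hx⟩
    · exact ⟨0, fun h => absurd h hz⟩
  choose F hFlim using hlim
  have hunif := hC.tendstoUniformlyOn_of_tendsto fun z hz => hFlim z hz
  have hopen : IsOpen {z : ℂ | 0 < z.re ∧ z.re < 1} :=
    (isOpen_lt continuous_const Complex.continuous_re).inter
      (isOpen_lt Complex.continuous_re continuous_const)
  have hUlim : ∀ t : ℝ, Tendsto (fun n => U (-t) (S 0 (u n))) atTop (𝓝 (U (-t) y)) := fun t =>
    ((U (-t)).continuous.tendsto y).comp hSu
  refine ⟨F, ?_, ?_, ⟨D * ‖y‖, ?_⟩, ?_, ?_, ?_⟩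
  · refine hunif.continuousOn (Eventually.frequently (Eventually.of_forall fun n => ?_))
    exact fun z hz =>
      (differentiableAt_stripOrbit hS (u n) hz.1 hz.2).continuousAt.continuousWithinAt
  · refine (hunif.mono fun z hz => ⟨hz.1.le, hz.2.le⟩).tendstoLocallyUniformlyOn.differentiableOn
      (Eventually.of_forall fun n => ?_) hopen
    exact fun z hz =>
      (differentiableAt_stripOrbit hS (u n) hz.1.le hz.2.le).differentiableWithinAt
  · intro z h0 h1
    exact le_of_tendsto_of_tendsto' (hFlim z ⟨h0, h1⟩).norm (hSu.norm.const_mul D)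
      fun n => hF (u n) h0 h1
  · intro t
    refine tendsto_nhds_unique (hFlim _ (by simp)) ?_
    simp_rw [stripOrbit_left hS hinj hU]
    exact (hUlim t).const_smul _
  · intro t
    refine tendsto_nhds_unique (hFlim _ (by simp)) ?_
    simp_rw [stripOrbit_right hS hinj hU]
    exact ((S 0).continuous.tendsto _).comp ((hUlim t).const_smul _)
  · have h1 : Tendsto (fun n => S 0 (stripOrbit S θ (u n) θ)) atTop (𝓝 (S 0 (F θ))) :=
      ((S 0).continuous.tendsto _).comp (hFlim θ (by simp [hθ0.le, hθ1.le]))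
    refine tendsto_nhds_unique h1 ?_
    have e : ∀ n, S 0 (stripOrbit S θ (u n) θ) = powSubOne S (-θ : ℂ) (S 0 (u n)) := by
      intro n
      have hc : Commute (S 0) (powSubOne S (-θ : ℂ)) :=
        commute_powSubOne _ fun t ht => hS.comm le_rfl ht.le
      rw [stripOrbit, gaussFactor_self, one_smul,
        hS.powSubTwo_eq_right (by simpa using hθ1), sub_sub_cancel_left]
      exact congrArg (fun T : X →L[ℂ] X => T (u n)) hc.eq
    simp_rw [e]
    exact ((powSubOne S (-θ : ℂ)).continuous.tendsto _).comp hSu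

end

end Strip

/-! ### The resolvent family of an invertible sectorial operator -/

section Operator

variable {X : Type*} [NormedAddCommGroup X] [NormedSpace ℂ X] {A : X →ₗ.[ℂ] X}

theorem neg_notMem_closure_sector {φ t : ℝ} (hφ : φ < Real.pi / 2) (ht : 0 < t) :
    (-(t : ℂ)) ∉ closure (sector φ) := by
  intro h
  have hsub : closure (sector φ) ⊆ {z : ℂ | 0 ≤ z.re} := by
    refine closure_minimal (fun z hz => ?_) (isClosed_le continuous_const Complex.continuous_re)
    rcases Complex.abs_arg_lt_pi_div_two_iff.1 (hz.2.trans hφ) with h | h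
    · exact h.le
    · exact absurd h hz.1
  have := hsub h
  simp at this
  linarith

theorem neg_mem_resolventSet (hA : IsSectorial A) (hA0 : IsInvertible A) {t : ℝ} (ht : 0 ≤ t) :
    (-(t : ℂ)) ∈ resolventSet A := by
  rcases ht.eq_or_lt with rfl | ht
  · simpa using! hA0
  · obtain ⟨φ, hφ, hsp, -⟩ := hA.resolvent_bound
    by_contra h
    exact neg_notMem_closure_sector hφ.2 ht (hsp h)

theorem shiftInv_mem_domain (hA : IsSectorial A) (hA0 : IsInvertible A) {t : ℝ} (ht : 0 ≤ t)
    (y : X) : ∃ h : shiftInv A t y ∈ A.domain, (t : ℂ) • shiftInv A t y + A ⟨_, h⟩ = y := by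
  obtain ⟨h, e⟩ := (isResolventAt_resolvent (neg_mem_resolventSet hA hA0 ht)).1 y
  have h' : shiftInv A t y ∈ A.domain := by
    simpa [shiftInv] using A.domain.neg_mem h
  refine ⟨h', ?_⟩
  have e2 : A ⟨_, h'⟩ = -A ⟨_, h⟩ := by
    rw [← A.map_neg]
    congr 1
  rw [e2]
  refine Eq.trans ?_ e
  simp [shiftInv, sub_eq_add_neg]

theorem shiftInv_apply_add (hA : IsSectorial A) (hA0 : IsInvertible A) {t : ℝ} (ht : 0 ≤ t)
    (x : A.domain) : shiftInv A t ((t : ℂ) • (x : X) + A x) = x := by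
  have e := (isResolventAt_resolvent (neg_mem_resolventSet hA hA0 ht)).2 x
  rw [shiftInv, neg_apply, ← map_neg, ← e]
  congr 1
  rw [e]
  simp [sub_eq_add_neg, add_comm]

theorem shiftInv_sub_eq (hA : IsSectorial A) (hA0 : IsInvertible A) {s t : ℝ} (hs : 0 ≤ s)
    (ht : 0 ≤ t) :
    shiftInv A s - shiftInv A t = ((t - s : ℝ) : ℂ) • (shiftInv A s * shiftInv A t) := by
  ext y
  obtain ⟨h, e⟩ := shiftInv_mem_domain hA hA0 ht y
  have e2 := shiftInv_apply_add hA hA0 hs ⟨_, h⟩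
  have e3 : shiftInv A s y = shiftInv A s ((s : ℂ) • shiftInv A t y + A ⟨_, h⟩) +
      ((t - s : ℝ) : ℂ) • shiftInv A s (shiftInv A t y) := by
    have h2 : y = ((s : ℂ) • shiftInv A t y + A ⟨_, h⟩) + ((t - s : ℝ) : ℂ) • shiftInv A t y :=
      e.symm.trans (by push_cast; module)
    refine (congrArg (shiftInv A s) h2).trans ?_
    rw [(shiftInv A s).map_add _ (_ • _), (shiftInv A s).map_smul ((t - s : ℝ) : ℂ)]
  rw [e2] at e3
  change shiftInv A s y - shiftInv A t y = ((t - s : ℝ) : ℂ) • shiftInv A s (shiftInv A t y)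
  rw [e3]
  simp

/-- Sectoriality bounds `t ‖S t‖`; the resolvent identity with `S 0`, available by invertibility,
then bounds `‖S t‖` itself. The sum of the two bounds is `L`. -/
theorem exists_isResolventFamily (hA : IsSectorial A) (hA0 : IsInvertible A) :
    ∃ L : ℝ, IsResolventFamily (shiftInv A) L := by
  obtain ⟨φ, hφ, -, K, hK⟩ := hA.resolvent_bound
  have hb : ∀ t : ℝ, 0 < t → t * ‖shiftInv A t‖ ≤ K := by
    intro t ht
    have := hK _ (neg_notMem_closure_sector hφ.2 ht)
    rw [norm_smul, norm_neg, Complex.norm_real, Real.norm_of_nonneg ht.le] at this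
    rwa [shiftInv, norm_neg]
  have hK0 : 0 ≤ K := le_trans (by positivity) (hb 1 one_pos)
  refine ⟨(1 + K) * ‖shiftInv A 0‖ + K, fun s t hs ht => shiftInv_sub_eq hA hA0 hs ht, ?_⟩
  intro t ht
  rw [le_div_iff₀ (by linarith)]
  have hb' : t * ‖shiftInv A t‖ ≤ K := by
    rcases ht.eq_or_lt with rfl | ht
    · simpa using hK0
    · exact hb t ht
  have e := shiftInv_sub_eq hA hA0 le_rfl ht (A := A)
  have e2 : shiftInv A t = shiftInv A 0 - (t : ℂ) • (shiftInv A 0 * shiftInv A t) := by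
    rw [sub_zero] at e
    rw [← e]
    abel
  have h2 : ‖shiftInv A t‖ ≤ ‖shiftInv A 0‖ + K * ‖shiftInv A 0‖ := by
    calc ‖shiftInv A t‖ ≤ ‖shiftInv A 0‖ + ‖(t : ℂ) • (shiftInv A 0 * shiftInv A t)‖ := by
          nth_rewrite 1 [e2]
          exact norm_sub_le _ _
      _ ≤ ‖shiftInv A 0‖ + t * (‖shiftInv A 0‖ * ‖shiftInv A t‖) := by
          rw [norm_smul, Complex.norm_real, Real.norm_of_nonneg ht]
          gcongr
          exact norm_mul_le _ _
      _ = ‖shiftInv A 0‖ + (t * ‖shiftInv A t‖) * ‖shiftInv A 0‖ := by ring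
      _ ≤ _ := by gcongr
  linarith

theorem apply_shiftInv_zero (hA : IsSectorial A) (hA0 : IsInvertible A) (y : X) :
    ∃ h : shiftInv A 0 y ∈ A.domain, A ⟨_, h⟩ = y := by
  simpa using shiftInv_mem_domain hA hA0 le_rfl y

theorem shiftInv_zero_apply (hA : IsSectorial A) (hA0 : IsInvertible A) (x : A.domain) :
    shiftInv A 0 (A x) = x := by
  simpa using shiftInv_apply_add hA hA0 le_rfl x

theorem shiftInv_zero_injective (hA : IsSectorial A) (hA0 : IsInvertible A) :
    Function.Injective (shiftInv A 0) := by
  intro x y hxy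
  obtain ⟨h, e⟩ := apply_shiftInv_zero hA hA0 x
  obtain ⟨h', e'⟩ := apply_shiftInv_zero hA hA0 y
  rw [← e, ← e']
  congr 1
  exact Subtype.ext hxy

theorem denseRange_shiftInv_zero (hA : IsSectorial A) (hA0 : IsInvertible A) :
    DenseRange (shiftInv A 0) :=
  hA.dense_domain.mono fun x hx => ⟨A ⟨x, hx⟩, shiftInv_zero_apply hA hA0 ⟨x, hx⟩⟩

/-! ### Fractional powers -/

theorem powOrder_eq_one {z : ℂ} (hz : |z.re| < 1) : powOrder z = 1 := by
  rw [powOrder, Nat.floor_eq_zero.2 hz]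

/-- With `N = A (1 + A)⁻¹` the regularizer `A (1 + A)⁻²` is `N² A⁻¹`, and the regularized power is
`N² A ^ (z - 1)`. Since `N` has the left inverse `1 + A⁻¹`, the factor `N²` cancels. -/
theorem mem_fracPowGraph_iff [CompleteSpace X] (hA : IsSectorial A) (hA0 : IsInvertible A) {z : ℂ}
    (hz : |z.re| < 1) (x y : X) :
    (x, y) ∈ fracPowGraph A z ↔ powSubOne (shiftInv A) z x = shiftInv A 0 y := by
  obtain ⟨L, hS⟩ := exists_isResolventFamily hA hA0
  obtain ⟨hz0, hz1⟩ := abs_lt.1 hz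
  set S := shiftInv A with hSdef
  set N : X →L[ℂ] X := 1 - S 1 with hN
  have hreg : ∀ t : ℝ, regularizer A 1 t = (1 - (t : ℂ) • S t) * S t := fun t => by
    rw [regularizer, pow_one, pow_one]
  have h01 := hS.smul_mul_eq le_rfl zero_le_one
  rw [zero_add, Complex.ofReal_one, one_smul] at h01
  have hcomm := hS.comm zero_le_one le_rfl
  have hN0 : N * S 0 = S 1 := by
    rw [hN, sub_mul, one_mul, h01]
    abel
  have hNinv : (1 + S 0) * N = 1 := by
    rw [hN, mul_sub, mul_one, add_mul, one_mul, ← hcomm, h01]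
    abel
  have hNN : N * N * S 0 = regularizer A 1 1 := by
    rw [hreg, Complex.ofReal_one, one_smul, mul_assoc, hN0]
  have hint : ∀ t ∈ Ioi (0 : ℝ), regularizer A 1 t * regularizer A 1 1 = N * N * (S t * S t) := by
    intro t ht
    have ht : 0 < t := ht
    have h0t := hS.smul_mul_eq le_rfl ht.le
    rw [zero_add] at h0t
    have e1 : (1 - (t : ℂ) • S t) * S 0 = S t := by
      rw [sub_mul, one_mul, smul_mul_assoc, h0t]
      abel
    have c1 : Commute (S t) N :=
      (Commute.one_right _).sub_right (hS.comm ht.le zero_le_one)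
    have c2 : Commute (S t) (S 0) := hS.comm ht.le le_rfl
    rw [← hNN, hreg]
    calc (1 - (t : ℂ) • S t) * S t * (N * N * S 0)
        = (1 - (t : ℂ) • S t) * (S t * (N * N * S 0)) := mul_assoc _ _ _
      _ = (1 - (t : ℂ) • S t) * (N * N * S 0 * S t) := by
          rw [((c1.mul_right c1).mul_right c2).eq]
      _ = (1 - (t : ℂ) • S t) * (S 0 * (N * N) * S t) := by
          have c3 : Commute (S 0) N :=
            (Commute.one_right _).sub_right (hS.comm le_rfl zero_le_one)
          rw [(c3.mul_right c3).eq]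
      _ = (1 - (t : ℂ) • S t) * S 0 * (N * N) * S t := by simp only [mul_assoc]
      _ = S t * (N * N) * S t := by rw [e1]
      _ = N * N * (S t * S t) := by rw [(c1.mul_right c1).eq, mul_assoc]
  have hpow : regularizedPow A z = N * N * powSubOne S z := by
    have hi := hS.integrableOn_powIntegral hz0 hz1
    have e1 : N * N * powIntegral S z = _ :=
      ((ContinuousLinearMap.mul ℂ (X →L[ℂ] X) (N * N)).integral_comp_comm hi).symm
    rw [regularizedPow, powOrder_eq_one hz, powSubOne, mul_smul_comm, e1]
    congr 1
    -- The order is `1`, so the numerator of the coefficient is `Γ(2) = 1`.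
    · rw [powCoeff, Nat.cast_one, mul_one, show (2 : ℂ) = 1 + 1 by norm_num,
        Complex.Gamma_add_one _ one_ne_zero, Complex.Gamma_one, mul_one, one_div, mul_inv]
    · refine setIntegral_congr_fun measurableSet_Ioi fun t ht => ?_
      simp only [ContinuousLinearMap.mul_apply', mul_smul_comm]
      rw [hint t ht, Nat.cast_one, add_sub_cancel_right]
  have hNinj : Function.Injective N := by
    intro a b hab
    have := congrArg (1 + S 0 : X →L[ℂ] X) hab
    change ((1 + S 0) * N) a = ((1 + S 0) * N) b at this
    simpa [hNinv] using! this
  rw [fracPowGraph, LinearMap.mem_ker, powOrder_eq_one hz, hpow, ← hNN]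
  change N (N (powSubOne S z x)) - N (N (S 0 y)) = 0 ↔ _
  rw [sub_eq_zero, hNinj.eq_iff, hNinj.eq_iff]

theorem fracPow_graph [CompleteSpace X] (hA : IsSectorial A) (hA0 : IsInvertible A) {z : ℂ}
    (hz : |z.re| < 1) : (fracPow A z).graph = fracPowGraph A z := by
  refine Submodule.toLinearPMap_graph_eq _ ?_
  rintro ⟨x, y⟩ hxy rfl
  rw [mem_fracPowGraph_iff hA hA0 hz, map_zero] at hxy
  exact (shiftInv_zero_injective hA hA0 (hxy.symm.trans (map_zero _).symm))

theorem mem_fracPow_domain_iff [CompleteSpace X] (hA : IsSectorial A) (hA0 : IsInvertible A) {z : ℂ}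
    (hz : |z.re| < 1) (x : X) :
    x ∈ (fracPow A z).domain ↔ ∃ y, powSubOne (shiftInv A) z x = shiftInv A 0 y := by
  simp_rw [LinearPMap.mem_domain_iff, fracPow_graph hA hA0 hz, mem_fracPowGraph_iff hA hA0 hz]

theorem powSubOne_eq_fracPow [CompleteSpace X] (hA : IsSectorial A) (hA0 : IsInvertible A) {z : ℂ}
    (hz : |z.re| < 1) (x : (fracPow A z).domain) :
    powSubOne (shiftInv A) z x = shiftInv A 0 (fracPow A z x) := by
  rw [← mem_fracPowGraph_iff hA hA0 hz, ← fracPow_graph hA hA0 hz]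
  exact LinearPMap.mem_graph _ x

theorem exists_isImaginaryPowers [CompleteSpace X] (hA : IsSectorial A) (hA0 : IsInvertible A)
    (hbip : HasBoundedImaginaryPowers A) {M ω : ℝ} (hM : 0 ≤ M)
    (hb : ∀ (t : ℝ) (x : (fracPow A (t * Complex.I)).domain),
      ‖fracPow A (t * Complex.I) x‖ ≤ M * Real.exp (ω * |t|) * ‖(x : X)‖) :
    ∃ U : ℝ → X →L[ℂ] X, IsImaginaryPowers (shiftInv A) U M ω := by
  have hmem : ∀ (t : ℝ) (x : X), x ∈ (fracPow A (t * Complex.I)).domain := fun t x => by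
    rw [(hbip t).1]
    trivial
  refine ⟨fun t => LinearMap.mkContinuous ((fracPow A (t * Complex.I)).toFun ∘ₗ
    LinearMap.id.codRestrict _ (hmem t)) (M * Real.exp (ω * |t|)) fun x => hb t ⟨x, hmem t x⟩,
    ?_, fun t => LinearMap.mkContinuous_norm_le _ (by positivity) _⟩
  intro t
  ext x
  exact powSubOne_eq_fracPow hA hA0 (by simp) ⟨x, hmem t x⟩

end Operator

/-! ### The interpolation couple `(X, D(A))` -/

section Couple

variable {X : Type*} [NormedAddCommGroup X] [NormedSpace ℂ X] {A : X →ₗ.[ℂ] X}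

/-- `A⁻¹` is isometric into `D(A)` because the norm there is `‖A x‖`. It turns the boundary values
on `Re z = 1` into continuous functions with values in `D(A)`. -/
theorem exists_domainSpace_inverse (hA : IsSectorial A) (hA0 : IsInvertible A) :
    ∃ ι : X →ₗᵢ[ℂ] DomainSpace A hA0,
      ∀ v, DomainSpace.incl A hA0 (ι v) = shiftInv A 0 v := by
  let f : X →ₗ[ℂ] DomainSpace A hA0 := show X →ₗ[ℂ] A.domain from
    (shiftInv A 0 : X →ₗ[ℂ] X).codRestrict A.domain fun v => (apply_shiftInv_zero hA hA0 v).1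
  refine ⟨⟨f, fun v => ?_⟩, fun v => rfl⟩
  rw [DomainSpace.norm_def]
  exact congrArg norm (apply_shiftInv_zero hA hA0 v).2

theorem incl_eq_shiftInv (hA : IsSectorial A) (hA0 : IsInvertible A) (d : DomainSpace A hA0) :
    DomainSpace.incl A hA0 d = shiftInv A 0 (DomainSpace.apply A hA0 d) :=
  (shiftInv_zero_apply hA hA0 d).symm

end Couple

/-! ### The sum space of a couple -/

section SumSpace

variable {X Y Z : Type*} [NormedAddCommGroup X] [NormedSpace ℂ X]
  [NormedAddCommGroup Y] [NormedSpace ℂ Y]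
  [AddCommGroup Z] [Module ℂ Z] [TopologicalSpace Z] [IsTopologicalAddGroup Z]
  (i : X →L[ℂ] Z) (k : Y →L[ℂ] Z)

theorem SumSpace.toAmbient_mk (x : X) (y : Y) :
    SumSpace.toAmbient i k (SumSpace.mk i k x y) = i x + k y := by
  change sumMap i k (WithLp.toLp 1 (x, y)) = i x + k y
  simp [sumMap]

theorem SumSpace.toAmbient_injective : Function.Injective (SumSpace.toAmbient i k) := by
  rw [← LinearMap.ker_eq_bot]
  exact Submodule.ker_liftQ_eq_bot _ _ _ le_rfl

theorem SumSpace.continuous_toAmbient : Continuous (SumSpace.toAmbient i k) :=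
  continuous_quot_lift _ (sumMap i k).continuous

/-- A closed kernel makes the quotient seminorm of the sum space a norm. -/
theorem SumSpace.isClosed_ker [T1Space Z] :
    IsClosed (LinearMap.ker (sumMap i k : WithLp 1 (X × Y) →ₗ[ℂ] Z) : Set (WithLp 1 (X × Y))) :=
  (sumMap i k).isClosed_ker

theorem SumSpace.exists_mkLeft :
    ∃ P : X →L[ℂ] SumSpace i k, ∀ x, P x = SumSpace.mk i k x 0 := by
  refine ⟨⟨(LinearMap.ker (sumMap i k : WithLp 1 (X × Y) →ₗ[ℂ] Z)).mkQ ∘ₗ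
    ((WithLp.prodContinuousLinearEquiv 1 ℂ X Y).symm : X × Y →ₗ[ℂ] WithLp 1 (X × Y)) ∘ₗ
      LinearMap.inl ℂ X Y, ?_⟩, fun x => rfl⟩
  refine continuous_quot_mk.comp ((WithLp.prodContinuousLinearEquiv 1 ℂ X Y).symm.continuous.comp ?_)
  exact (ContinuousLinearMap.inl ℂ X Y).continuous

theorem StripFunction.bdNorm_nonneg (f : StripFunction i k) : 0 ≤ f.bdNorm :=
  (norm_nonneg _).trans (le_max_left _ _)

end SumSpace

/-! ### The two embeddings for the couple `(X, D(A))` -/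

section Interpolation

variable {X : Type*} [NormedAddCommGroup X] [NormedSpace ℂ X] [CompleteSpace X] {A : X →ₗ.[ℂ] X}
  {U : ℝ → X →L[ℂ] X} {M ω θ : ℝ}

/-- As `A` maps `D(A)` isometrically to `X`, the right boundary values are `A⁻¹ r(t)` with `r` of
the same sup norm, which is the form required by `exists_powSubOne_eq_of_strip`. -/
theorem exists_fracPow_eq_of_stripFunction (hA : IsSectorial A) (hA0 : IsInvertible A)
    (hU : IsImaginaryPowers (shiftInv A) U M ω) (hθ : θ ∈ Ioo (0 : ℝ) 1)
    (f : StripFunction (ContinuousLinearMap.id ℂ X) (DomainSpace.incl A hA0)) :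
    ∃ y, powSubOne (shiftInv A) θ (SumSpace.toAmbient _ _ (f.toFun θ)) = shiftInv A 0 y ∧
      ‖y‖ ≤ embeddingConst M ω θ * f.bdNorm := by
  obtain ⟨L, hS⟩ := exists_isResolventFamily hA hA0
  let T : SumSpace (ContinuousLinearMap.id ℂ X) (DomainSpace.incl A hA0) →L[ℂ] X :=
    ⟨SumSpace.toAmbient _ _, SumSpace.continuous_toAmbient _ _⟩
  have := SumSpace.isClosed_ker (ContinuousLinearMap.id ℂ X) (DomainSpace.incl A hA0)
  obtain ⟨B, hB⟩ := f.bounded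
  have happ : ∀ d : DomainSpace A hA0, ‖DomainSpace.apply A hA0 d‖ = ‖d‖ := fun _ => rfl
  have happc : Continuous (DomainSpace.apply A hA0) :=
    (AddMonoidHomClass.isometry_of_norm (DomainSpace.apply A hA0) happ).continuous
  refine exists_powSubOne_eq_of_strip hS (shiftInv_zero_injective hA hA0)
    (denseRange_shiftInv_zero hA hA0) hU hθ (f := fun z => T (f.toFun z)) (l := f.left)
    (r := fun t => DomainSpace.apply A hA0 (f.right t)) (B := ‖T‖ * B) ?_ ?_ ?_ ?_ ?_ ?_ ?_ ?_ ?_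
  · exact T.continuous.comp_continuousOn f.continuousOn
  · exact T.differentiable.comp_differentiableOn f.differentiableOn
  · exact fun z h0 h1 => (T.le_opNorm _).trans
      (mul_le_mul_of_nonneg_left (hB z h0 h1) (norm_nonneg _))
  · exact f.left.continuous
  · exact happc.comp f.right.continuous
  · exact fun t => (f.left.norm_coe_le_norm t).trans (le_max_left _ _)
  · exact fun t => (f.right.norm_coe_le_norm t).trans (le_max_right _ _)
  · intro t
    change SumSpace.toAmbient _ _ _ = _
    rw [f.left_eq, SumSpace.toAmbient_mk, map_zero, add_zero]
    rfl
  · intro t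
    change SumSpace.toAmbient _ _ _ = _
    rw [f.right_eq, SumSpace.toAmbient_mk, map_zero, zero_add, incl_eq_shiftInv hA]

theorem exists_stripFunction_of_fracPow_eq (hA : IsSectorial A) (hA0 : IsInvertible A)
    (hU : IsImaginaryPowers (shiftInv A) U M ω) (hθ : θ ∈ Ioo (0 : ℝ) 1) {κ : ℂ} (hκ : κ ≠ 0)
    (hlaw : powSubOne (shiftInv A) (-θ : ℂ) * powSubOne (shiftInv A) (θ : ℂ) =
      κ • (shiftInv A 0 * shiftInv A 0)) {x y : X}
    (hxy : powSubOne (shiftInv A) θ x = shiftInv A 0 y) :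
    ∃ f : StripFunction (ContinuousLinearMap.id ℂ X) (DomainSpace.incl A hA0),
      SumSpace.toAmbient _ _ (f.toFun θ) = x ∧
        f.bdNorm ≤ ‖κ‖⁻¹ * boundaryConst M ω * ‖y‖ := by
  obtain ⟨L, hS⟩ := exists_isResolventFamily hA hA0
  have hinj := shiftInv_zero_injective hA hA0
  have hdense := denseRange_shiftInv_zero hA hA0
  obtain ⟨F, hFc, hFd, ⟨B, hFB⟩, hF0, hF1, hFθ⟩ := exists_strip_function hS hinj hU hθ hdense y
  obtain ⟨P, hP⟩ := SumSpace.exists_mkLeft (ContinuousLinearMap.id ℂ X) (DomainSpace.incl A hA0)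
  have := SumSpace.isClosed_ker (ContinuousLinearMap.id ℂ X) (DomainSpace.incl A hA0)
  obtain ⟨ι, hι⟩ := exists_domainSpace_inverse hA hA0
  have hM := hU.nonneg
  have hC0 : 0 ≤ ‖κ‖⁻¹ * boundaryConst M ω * ‖y‖ := by unfold boundaryConst; positivity
  have hUc : Continuous fun t : ℝ => U (-t) y :=
    hU.continuous_apply hS hinj hdense continuous_neg continuous_const
  have hgaussc := (differentiable_gaussFactor θ).continuous
  have hl : Continuous fun t : ℝ => κ⁻¹ • gaussFactor θ (t * Complex.I) • U (-t) y :=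
    ((hgaussc.comp (by fun_prop)).smul hUc).const_smul _
  have hr : Continuous fun t : ℝ => κ⁻¹ • gaussFactor θ (1 + t * Complex.I) • U (-t) y :=
    ((hgaussc.comp (by fun_prop)).smul hUc).const_smul _
  have hlb : ∀ t : ℝ, ‖κ⁻¹ • gaussFactor θ (t * Complex.I) • U (-t) y‖ ≤
      ‖κ‖⁻¹ * boundaryConst M ω * ‖y‖ := fun t => by
    rw [norm_smul, norm_inv, mul_assoc]
    refine mul_le_mul_of_nonneg_left ?_ (by positivity)
    simpa using norm_boundary_le hU hθ (z := t * Complex.I) (by simp) (by simp) y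
  have hrb : ∀ t : ℝ, ‖κ⁻¹ • gaussFactor θ (1 + t * Complex.I) • U (-t) y‖ ≤
      ‖κ‖⁻¹ * boundaryConst M ω * ‖y‖ := fun t => by
    rw [norm_smul, norm_inv, mul_assoc]
    refine mul_le_mul_of_nonneg_left ?_ (by positivity)
    simpa using norm_boundary_le hU hθ (z := 1 + t * Complex.I) (by simp) (by simp) y
  -- `A⁻² F(θ) = A⁻¹ A ^ (-θ - 1) y = A ^ (-θ - 1) A ^ (θ - 1) x = κ A⁻² x`, and `A⁻²` is injective.
  have hFx : F θ = κ • x := by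
    refine hinj (hinj ?_)
    have hc : Commute (shiftInv A 0) (powSubOne (shiftInv A) (-θ : ℂ)) :=
      commute_powSubOne _ fun t ht => hS.comm le_rfl ht.le
    have e1 : shiftInv A 0 (powSubOne (shiftInv A) (-θ : ℂ) y) =
        powSubOne (shiftInv A) (-θ : ℂ) (shiftInv A 0 y) :=
      congrArg (fun T : X →L[ℂ] X => T y) hc.eq
    have e2 := congrArg (fun T : X →L[ℂ] X => T x) hlaw
    rw [hFθ, e1, ← hxy, map_smul, map_smul]
    exact e2
  refine ⟨{
    toFun := fun z => P (κ⁻¹ • F z)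
    left := BoundedContinuousFunction.ofNormedAddCommGroup _ hl _ hlb
    right := BoundedContinuousFunction.ofNormedAddCommGroup
      (fun t : ℝ => ι (κ⁻¹ • gaussFactor θ (1 + t * Complex.I) • U (-t) y))
      (ι.continuous.comp hr) _ fun t => by
        rw [ι.norm_map]
        exact hrb t
    continuousOn := P.continuous.comp_continuousOn (hFc.const_smul _)
    bounded := ⟨‖P‖ * (‖κ⁻¹‖ * B), fun z h0 h1 => (P.le_opNorm _).trans ?_⟩
    differentiableOn := P.differentiable.comp_differentiableOn (hFd.const_smul κ⁻¹)
    left_eq := fun t => ?_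
    right_eq := fun t => ?_ }, ?_, ?_⟩
  · rw [norm_smul]
    have := hFB z h0 h1
    gcongr
  · rw [hP, hF0]
    rfl
  · refine SumSpace.toAmbient_injective _ _ ?_
    rw [hP, hF1, SumSpace.toAmbient_mk, SumSpace.toAmbient_mk, map_zero, map_zero, add_zero,
      zero_add, ← map_smul]
    exact (hι _).symm
  · change SumSpace.toAmbient _ _ (P (κ⁻¹ • F θ)) = x
    rw [hP, SumSpace.toAmbient_mk, map_zero, add_zero, hFx, smul_smul, inv_mul_cancel₀ hκ, one_smul]
    rfl
  · refine max_le ?_ ?_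
    · exact BoundedContinuousFunction.norm_ofNormedAddCommGroup_le _ hC0 hlb
    · refine BoundedContinuousFunction.norm_ofNormedAddCommGroup_le _ hC0 fun t => ?_
      rw [ι.norm_map]
      exact hrb t

end Interpolation

end BIP

end

/-! ### The equivalence of norms, uniformly in the family -/

theorem mainTheorem11 {X : Type*} [NormedAddCommGroup X] [NormedSpace ℂ X] [CompleteSpace X]
    {J : Type*} (A : J → X →ₗ.[ℂ] X)
    (hsec : ∀ j, BIP.IsSectorial (A j)) (hinv : ∀ j, BIP.IsInvertible (A j))
    (hbip : ∀ j, BIP.HasBoundedImaginaryPowers (A j))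
    (M ω : ℝ) (hM : 0 ≤ M) (hω : 0 ≤ ω)
    (hbound : ∀ (j : J) (t : ℝ) (x : (BIP.fracPow (A j) (t * Complex.I)).domain),
      ‖BIP.fracPow (A j) (t * Complex.I) x‖ ≤ M * Real.exp (ω * |t|) * ‖(x : X)‖)
    (θ : ℝ) (hθ : θ ∈ Set.Ioo (0 : ℝ) 1) :
    ∃ C : ℝ, 0 < C ∧ ∀ j : J,
      ((BIP.fracPow (A j) θ).domain : Set X) =
          BIP.interpSpace (ContinuousLinearMap.id ℂ X) (BIP.DomainSpace.incl (A j) (hinv j)) θ ∧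
        ∀ x : (BIP.fracPow (A j) θ).domain,
          C⁻¹ * ‖BIP.fracPow (A j) θ x‖ ≤
              BIP.interpNorm (ContinuousLinearMap.id ℂ X)
                (BIP.DomainSpace.incl (A j) (hinv j)) θ (x : X) ∧
            BIP.interpNorm (ContinuousLinearMap.id ℂ X)
                (BIP.DomainSpace.incl (A j) (hinv j)) θ (x : X) ≤
              C * ‖BIP.fracPow (A j) θ x‖ := by
  have hθ1 : |((θ : ℝ) : ℂ).re| < 1 := by
    rw [Complex.ofReal_re, abs_of_pos hθ.1]
    exact hθ.2
  -- The constant `κ` is fixed before `j`, as uniformity in the family requires.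
  obtain ⟨κ, hκ, hlaw⟩ := BIP.exists_powSubOne_mul (x := θ) (by linarith [hθ.1]) hθ.2
  set C₁ := BIP.embeddingConst M ω θ
  set C₂ := ‖κ‖⁻¹ * BIP.boundaryConst M ω
  -- One constant serves both inequalities; the summand `1` keeps it positive even if `M = 0`.
  have hC : 0 < 1 + |C₁| + |C₂| := by positivity
  refine ⟨1 + |C₁| + |C₂|, hC, fun j => ?_⟩
  obtain ⟨U, hU⟩ := BIP.exists_isImaginaryPowers (hsec j) (hinv j) (hbip j) hM (hbound j)
  obtain ⟨L, hS⟩ := BIP.exists_isResolventFamily (hsec j) (hinv j)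
  have hinj := BIP.shiftInv_zero_injective (hsec j) (hinv j)
  have hlawj := hlaw hS hinj
  refine ⟨?_, fun x => ?_⟩
  · ext x
    rw [SetLike.mem_coe, BIP.mem_fracPow_domain_iff (hsec j) (hinv j) hθ1]
    constructor
    · rintro ⟨y, hy⟩
      obtain ⟨f, hf, -⟩ := BIP.exists_stripFunction_of_fracPow_eq (hsec j) (hinv j) hU hθ hκ hlawj hy
      exact ⟨f, hf⟩
    · rintro ⟨f, rfl⟩
      obtain ⟨y, hy, -⟩ := BIP.exists_fracPow_eq_of_stripFunction (hsec j) (hinv j) hU hθ f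
      exact ⟨y, hy⟩
  · have hx := BIP.powSubOne_eq_fracPow (hsec j) (hinv j) hθ1 x
    obtain ⟨f₀, hf₀, hb₀⟩ :=
      BIP.exists_stripFunction_of_fracPow_eq (hsec j) (hinv j) hU hθ hκ hlawj hx
    constructor
    · refine le_csInf ⟨_, f₀, hf₀, rfl⟩ ?_
      rintro _ ⟨f, hf, rfl⟩
      obtain ⟨y, hy, hb⟩ := BIP.exists_fracPow_eq_of_stripFunction (hsec j) (hinv j) hU hθ f
      rw [hf, hx] at hy
      rw [hinj hy, inv_mul_le_iff₀ hC]
      refine hb.trans (mul_le_mul_of_nonneg_right ?_ (BIP.StripFunction.bdNorm_nonneg _ _ f))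
      linarith [le_abs_self C₁, abs_nonneg C₂]
    · have hbdd : BddBelow {r | ∃ f : BIP.StripFunction (ContinuousLinearMap.id ℂ X)
          (BIP.DomainSpace.incl (A j) (hinv j)),
          BIP.SumSpace.toAmbient _ _ (f.toFun θ) = (x : X) ∧ f.bdNorm = r} := by
        refine ⟨0, ?_⟩
        rintro _ ⟨f, -, rfl⟩
        exact BIP.StripFunction.bdNorm_nonneg _ _ f
      refine (csInf_le hbdd ⟨f₀, hf₀, rfl⟩).trans (hb₀.trans ?_)
      refine mul_le_mul_of_nonneg_right ?_ (norm_nonneg _)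
      linarith [le_abs_self C₂, abs_nonneg C₁]
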